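/- **Setting.** Let $R$ be an integral domain with field of fractions $\mathbb F$. A cell datum for a unital $R$-algebra $A$ consists of an $R$-linear involutive anti-automorphism $*$, a finite poset $(\widehat A,\unrhd)$, finite non-empty index sets $I(\lambda)$ ($\lambda\in\widehat A$) and an $R$-basis $\{c^\lambda_{pq} : \lambda\in\widehat A,\ p,q\in I(\lambda)\}$ of $A$ such that, with $A^{\rhd\lambda}=\mathrm{span}\{c^\mu_{pq}:\mu\rhd\lambda\}$, one has $(c^\lambda_{pq})^*\equiv c^\lambda_{qp}$ and $c^\lambda_{pq}a\equiv\sum_{v} r(a;q,v)\,c^\lambda_{pv}$ modulo $A^{\rhd\lambda}$ for all $a \in A$, where $r(a;q,v)\in R$ does not depend on $p$. The cell module $\Delta(\lambda)$ is the right $A$-module that is free on $\{c^\lambda_q\}$ with $c^\lambda_q a=\sum_v r(a;q,v)c^\lambda_v$. For $x=\sum_p x_pc^\lambda_p$ and $y=\sum_q y_qc^\lambda_q$ put $\alpha_\lambda^{-1}(x^*\otimes y)=\sum_{p,q} x_py_q\,c^\lambda_{pq}+A^{\rhd\lambda}$; the bilinear form on $\Delta(\lambda)$ is defined by $x\,\alpha_\lambda^{-1}(y^*\otimes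 z)=\langle x,y\rangle z$. All this extends to $A^{\mathbb F}=A\otimes_R\mathbb F$ and $\Delta^{\mathbb F}(\lambda)=\Delta(\lambda)\otimes_R\mathbb F$. Let $(A_r)_{r\ge0}$ be an increasing sequence of cellular $R$-algebras with unital inclusions and consistent involutions, with posets $\widehat A_r$ and cell modules $\Delta_r(\lambda)$, such that: - $A_0=R$; - each $\Delta_r(\lambda)$ is cyclic; fix a generator $\delta(\lambda)$; - a lift $m_\lambda$ of $\alpha_\lambda^{-1}(\delta(\lambda)^*\otimes\delta(\lambda))$ to $A_r$ with $m_\lambda^*=m_\lambda$ exists and is fixed; - each $A_r^{\mathbb F}$ is split semisimple; - for every $\mu\in\widehat A_{r+1}$ the restriction of $\Delta_{r+1}(\mu)$ to $A_r$ has a filtration $0=M_0\subseteq\dots\subseteq M_k=\Delta_{r+1}(\mu)$ by $A_r$-submodules with isomorphisms $M_j/M_{j-1}\cong\Delta_r(\lambda^{(j)})$ and $\lambda^{(1)}\rhd\dots\rhd\lambda^{(k)}$ (an order preserving cell filtration). Fix one for each $\mu$. The branching diagram has an edge $\lambda\to\mu$ iff $\Delta_r(\lambda)$ is one of the subquotients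 of such a filtration; - branching factors $d_{\lambda\to\mu}\in A_{r+1}$ are fixed such that, for $\lambda=\lambda^{(j)}$, $\delta(\mu)d_{\lambda\to\mu}\in M_j$ and its class corresponds to $\delta(\lambda)$ under $M_j/M_{j-1}\cong\Delta_r(\lambda)$; and for each edge there is $u_{\lambda\to\mu}\in A_{r+1}$ with $m_\mu d_{\lambda\to\mu}=u_{\lambda\to\mu}^*\,m_\lambda$. Let $\mathrm{Std}_r(\lambda)$ be the set of directed paths $\mathsf t=(\mathsf t(0)\to\mathsf t(1)\to\dots\to\mathsf t(r)=\lambda)$ in the branching diagram. Put $d_{\mathsf t}=d_{\mathsf t(r-1)\to\mathsf t(r)}\cdots d_{\mathsf t(0)\to\mathsf t(1)}$, $m^\lambda_{\mathsf s\mathsf t}=d_{\mathsf s}^*m_\lambda d_{\mathsf t}\in A_r$ and $m^\lambda_{\mathsf t}=\delta(\lambda)d_{\mathsf t}\in\Delta_r(\lambda)$. Let $z_s^\lambda$ be the minimal central idempotent of $A_s^{\mathbb F}$ that acts as the identity on $\Delta_s^{\mathbb F}(\lambda)$, and let $F_{\mathsf t}=\prod_{s=1}^r z_s^{\mathsf t(s)}$.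 Define $$f^\lambda_{\mathsf t}=m^\lambda_{\mathsf t}F_{\mathsf t}\in\Delta^{\mathbb F}_r(\lambda),\qquad F^\lambda_{\mathsf s\mathsf t}=F_{\mathsf s}\,m^\lambda_{\mathsf s\mathsf t}\,F_{\mathsf t}\in A^{\mathbb F}_r .$$ **Lemma.** Let $r\ge0$, $\lambda,\mu\in\widehat A_r$, $\mathsf s,\mathsf t\in\mathrm{Std}_r(\lambda)$ and $\mathsf u,\mathsf v\in\mathrm{Std}_r(\mu)$. 1. $f^\lambda_{\mathsf t}F^\mu_{\mathsf u\mathsf v}=\delta_{\lambda,\mu}\langle f^\lambda_{\mathsf t},f^\lambda_{\mathsf u}\rangle f^\lambda_{\mathsf v}$. 2. $F^\lambda_{\mathsf s\mathsf t}F^\mu_{\mathsf u\mathsf v}=\delta_{\lambda,\mu}\langle f^\lambda_{\mathsf t},f^\lambda_{\mathsf u}\rangle F^\lambda_{\mathsf s\mathsf v}$. 3. If $\lambda=\mu$, then $\langle f^\lambda_{\mathsf t},f^\lambda_{\mathsf u}\rangle\ne0$ if and only if $\mathsf t=\mathsf u$. 4. $\langle f^\lambda_{\mathsf t},f^\lambda_{\mathsf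 t}\rangle^{-1}F^\lambda_{\mathsf t\mathsf t}=F_{\mathsf t}$. 5. The elements $E^\lambda_{\mathsf s\mathsf t}=\langle f^\lambda_{\mathsf s},f^\lambda_{\mathsf s}\rangle^{-1}F^\lambda_{\mathsf s\mathsf t}$ form a complete family of matrix units of $A_r^{\mathbb F}$: $E^\lambda_{\mathsf s\mathsf t}E^\mu_{\mathsf u\mathsf v}=\delta_{\lambda,\mu}\delta_{\mathsf t,\mathsf u}E^\lambda_{\mathsf s\mathsf v}$; $E^\lambda_{\mathsf s\mathsf t}E^\lambda_{\mathsf t\mathsf s}=E^\lambda_{\mathsf s\mathsf s}=F_{\mathsf s}$; $\sum_{\lambda\in\widehat A_r}\sum_{\mathsf s\in\mathrm{Std}_r(\lambda)}E^\lambda_{\mathsf s\mathsf s}=1$; and the $E^\lambda_{\mathsf s\mathsf t}$ ($\lambda\in\widehat A_r$, $\mathsf s,\mathsf t\in\mathrm{Std}_r(\lambda)$) form an $\mathbb F$-basis of $A_r^{\mathbb F}$. -/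

import Mathlib

open scoped TensorProduct Matrix

noncomputable section

set_option linter.checkUnivs false

/-- A cell datum for the unital `R`-algebra `A`: an algebra involution `inv`, a finite poset `Λ`,
finite non-empty index sets `Idx μ`, and a cellular basis `c μ s t = basis ⟨μ, (s, t)⟩`.
The dominance relation `μ ⊵ ν` is written `ν ≤ μ`. -/
structure CellDatum.{u, v, w, w'} (R : Type u) (A : Type v) [CommRing R] [Ring A] [Algebra R A] where
  inv : A →ₗ[R] A
  inv_mul : ∀ a b, inv (a * b) = inv b * inv a
  inv_inv : ∀ a, inv (inv a) = a
  Λ : Type w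
  [order : PartialOrder Λ]
  [fintypeΛ : Fintype Λ]
  Idx : Λ → Type w'
  [fintypeIdx : ∀ μ, Fintype (Idx μ)]
  [nonemptyIdx : ∀ μ, Nonempty (Idx μ)]
  basis : Module.Basis (Σ μ : Λ, Idx μ × Idx μ) R A
  mul_mem : ∀ (μ : Λ) (t : Idx μ) (a : A), ∃ r : Idx μ → R, ∀ s : Idx μ,
    basis ⟨μ, (s, t)⟩ * a - ∑ v, r v • basis ⟨μ, (s, v)⟩ ∈
      Submodule.span R {x | ∃ (ν : Λ) (p q : Idx ν), μ < ν ∧ x = basis ⟨ν, (p, q)⟩}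
  inv_mem : ∀ (μ : Λ) (s t : Idx μ),
    inv (basis ⟨μ, (s, t)⟩) - basis ⟨μ, (t, s)⟩ ∈
      Submodule.span R {x | ∃ (ν : Λ) (p q : Idx ν), μ < ν ∧ x = basis ⟨ν, (p, q)⟩}

namespace CellDatum

attribute [instance] CellDatum.order CellDatum.fintypeΛ CellDatum.fintypeIdx
  CellDatum.nonemptyIdx

section

variable {R A : Type*} [CommRing R] [Ring A] [Algebra R A] (D : CellDatum R A)

/-- The cellular basis element `c^μ_{st}`. -/
def c (μ : D.Λ) (s t : D.Idx μ) : A := D.basis ⟨μ, (s, t)⟩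

/-- The ideal `A^{▷ μ}`: the span of the `c^ν_{pq}` with `ν ▷ μ`. -/
def above (μ : D.Λ) : Submodule R A :=
  Submodule.span R {x | ∃ (ν : D.Λ) (p q : D.Idx ν), μ < ν ∧ x = D.c ν p q}

/-- The cell module `Δ(μ)`: free over `R` on the basis `c^μ_t`, `t ∈ Idx μ`; an element is given
by its coordinates. -/
abbrev Cell (μ : D.Λ) : Type _ := D.Idx μ → R

/-- The coefficients `r(a; t, v)` in `c_{st} a ≡ ∑ v, r(a; t, v) c_{sv}` modulo `A^{▷ μ}`;
they do not depend on `s` (see `c_mul_sub_mem`), so they may be read off at `s = t`. -/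
def coeff (μ : D.Λ) (a : A) : Matrix (D.Idx μ) (D.Idx μ) R :=
  Matrix.of fun t v => D.basis.repr (D.c μ t t * a) ⟨μ, (t, v)⟩

/-- The right action of `A` on the cell module: `D.act μ a x` is `x a`, where
`c_t a = ∑ v, r(a; t, v) c_v`. -/
def act (μ : D.Λ) (a : A) (x : D.Cell μ) : D.Cell μ := x ᵥ* D.coeff μ a

/-- The representative `∑ x_s y_t c_{st}` of `α_μ⁻¹(x^* ⊗ y)`, where
`α_μ : A^{⊵ μ} / A^{▷ μ} → Δ(μ)^* ⊗ Δ(μ)` sends the class of `c_{st}` to `c_s^* ⊗ c_t`. -/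
def tens (μ : D.Λ) (x y : D.Cell μ) : A := ∑ s, ∑ t, (x s * y t) • D.c μ s t

/-- The bilinear form of the cell module. On the basis, `⟨c_t, c_u⟩` is the coefficient of `c_t`
in `c_t c_{ut}`; by `act_tens` this is the form with `x · α_μ⁻¹(y^* ⊗ z) = ⟨x, y⟩ z`. -/
def form (μ : D.Λ) (x y : D.Cell μ) : R :=
  ∑ t, ∑ u, x t * y u * D.coeff μ (D.c μ u t) t t

theorem repr_of_mem_above {μ : D.Λ} {x : A} (hx : x ∈ D.above μ) (s t : D.Idx μ) :
    D.basis.repr x ⟨μ, (s, t)⟩ = 0 := by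
  induction hx using Submodule.span_induction with
  | mem x h =>
    obtain ⟨ν, p, q, h, rfl⟩ := h
    have : (⟨ν, (p, q)⟩ : Σ μ : D.Λ, D.Idx μ × D.Idx μ) ≠ ⟨μ, (s, t)⟩ := by
      intro e
      have := congrArg Sigma.fst e
      exact h.ne this.symm
    rw [c, Module.Basis.repr_self]
    exact Finsupp.single_eq_of_ne this.symm
  | zero => simp
  | add x y _ _ hx hy => simp [hx, hy]
  | smul a x _ hx => simp [hx]

theorem repr_sum_right (μ : D.Λ) (s s' w : D.Idx μ) (r : D.Idx μ → R) :
    D.basis.repr (∑ v, r v • D.c μ s v) ⟨μ, (s', w)⟩ = by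
      classical exact if s = s' then r w else 0 := by
  classical
  simp only [map_sum, map_smul, c, Module.Basis.repr_self, Finsupp.coe_finsetSum,
    Finset.sum_apply, Finsupp.smul_apply, Finsupp.single_apply, smul_eq_mul, Sigma.mk.injEq,
    heq_eq_eq, Prod.mk.injEq, true_and, mul_ite, mul_one, mul_zero]
  split_ifs with h <;> simp [h]

theorem c_mul_sub_mem (μ : D.Λ) (s t : D.Idx μ) (a : A) :
    D.c μ s t * a - ∑ v, D.coeff μ a t v • D.c μ s v ∈ D.above μ := by
  obtain ⟨r, hr⟩ := D.mul_mem μ t a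
  have key : ∀ v, D.coeff μ a t v = r v := by
    intro v
    have h := D.repr_of_mem_above (μ := μ) (hr t) t v
    have h2 := D.repr_sum_right μ t t v r
    simp only [if_true] at h2
    rw [map_sub, Finsupp.sub_apply, sub_eq_zero] at h
    exact h.trans h2
  simp only [key]
  exact hr s

theorem above_mul_mem (μ : D.Λ) {x : A} (hx : x ∈ D.above μ) (a : A) :
    x * a ∈ D.above μ := by
  induction hx using Submodule.span_induction with
  | mem x h =>
    obtain ⟨ν, p, q, h, rfl⟩ := h
    have h1 := D.c_mul_sub_mem ν p q a
    have h2 : D.above ν ≤ D.above μ := Submodule.span_mono (by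
      rintro _ ⟨κ, p, q, h', rfl⟩; exact ⟨κ, p, q, h.trans h', rfl⟩)
    have h3 : ∑ v, D.coeff ν a q v • D.c ν p v ∈ D.above μ :=
      Submodule.sum_mem _ fun v _ => Submodule.smul_mem _ _
        (Submodule.subset_span ⟨ν, p, v, h, rfl⟩)
    simpa using Submodule.add_mem _ (h2 h1) h3
  | zero => simp
  | add x y _ _ hx hy => rw [add_mul]; exact Submodule.add_mem _ hx hy
  | smul r x _ hx => rw [smul_mul_assoc]; exact Submodule.smul_mem _ _ hx

theorem inv_mem_above (μ : D.Λ) {x : A} (hx : x ∈ D.above μ) : D.inv x ∈ D.above μ := by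
  induction hx using Submodule.span_induction with
  | mem x h =>
    obtain ⟨ν, p, q, h, rfl⟩ := h
    have h1 : D.inv (D.c ν p q) - D.c ν q p ∈ D.above ν := D.inv_mem ν p q
    have h2 : D.above ν ≤ D.above μ := Submodule.span_mono (by
      rintro _ ⟨κ, p, q, h', rfl⟩; exact ⟨κ, p, q, h.trans h', rfl⟩)
    have h3 : D.c ν q p ∈ D.above μ := Submodule.subset_span ⟨ν, q, p, h, rfl⟩
    simpa using Submodule.add_mem _ (h2 h1) h3
  | zero => simp
  | add x y _ _ hx hy => rw [map_add]; exact Submodule.add_mem _ hx hy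
  | smul r x _ hx => rw [map_smul]; exact Submodule.smul_mem _ _ hx

theorem act_one (μ : D.Λ) (x : D.Cell μ) : D.act μ 1 x = x := by
  classical
  have : D.coeff μ 1 = 1 := by
    ext t v
    simp [coeff, c, Finsupp.single_apply, Matrix.one_apply]
  rw [act, this, Matrix.vecMul_one]

theorem act_mul (μ : D.Λ) (a b : A) (x : D.Cell μ) :
    D.act μ (a * b) x = D.act μ b (D.act μ a x) := by
  have : D.coeff μ (a * b) = D.coeff μ a * D.coeff μ b := by
    ext t v
    have h1 := D.above_mul_mem μ (D.c_mul_sub_mem μ t t a) b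
    have h2 : ∑ w, D.coeff μ a t w • (D.c μ t w * b - ∑ v, D.coeff μ b w v • D.c μ t v)
        ∈ D.above μ :=
      Submodule.sum_mem _ fun w _ => Submodule.smul_mem _ _ (D.c_mul_sub_mem μ t w b)
    have h3 := D.repr_of_mem_above (Submodule.add_mem _ h1 h2) t v
    have e : (D.c μ t t * a - ∑ w, D.coeff μ a t w • D.c μ t w) * b +
        ∑ w, D.coeff μ a t w • (D.c μ t w * b - ∑ v, D.coeff μ b w v • D.c μ t v) =
        D.c μ t t * (a * b) - ∑ v, (D.coeff μ a * D.coeff μ b) t v • D.c μ t v := by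
      simp only [Matrix.mul_apply, Finset.sum_smul, smul_sub, Finset.sum_sub_distrib, sub_mul,
        Finset.sum_mul, smul_mul_assoc, Finset.smul_sum, smul_smul, mul_assoc]
      rw [Finset.sum_comm (γ := D.Idx μ)]
      abel
    have h4 := D.repr_sum_right μ t t v (fun v => (D.coeff μ a * D.coeff μ b) t v)
    simp only [if_true] at h4
    rw [e, map_sub, Finsupp.sub_apply, sub_eq_zero] at h3
    exact h3.trans h4
  rw [act, act, act, this, Matrix.vecMul_vecMul]

theorem repr_sum_left (μ : D.Λ) (s w w' : D.Idx μ) (r : D.Idx μ → R) :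
    D.basis.repr (∑ v, r v • D.c μ v s) ⟨μ, (w, w')⟩ = by
      classical exact if s = w' then r w else 0 := by
  classical
  simp only [map_sum, map_smul, c, Module.Basis.repr_self, Finsupp.coe_finsetSum,
    Finset.sum_apply, Finsupp.smul_apply, Finsupp.single_apply, smul_eq_mul, Sigma.mk.injEq,
    heq_eq_eq, Prod.mk.injEq, true_and, mul_ite, mul_one, mul_zero]
  split_ifs with h <;> simp [h]

theorem mul_above_mem (μ : D.Λ) {x : A} (hx : x ∈ D.above μ) (a : A) :
    a * x ∈ D.above μ := by
  have := D.inv_mem_above μ (D.above_mul_mem μ (D.inv_mem_above μ hx) (D.inv a))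
  rwa [D.inv_mul, D.inv_inv, D.inv_inv] at this

theorem mul_c_sub_mem (μ : D.Λ) (u v : D.Idx μ) (a : A) :
    a * D.c μ u v - ∑ w, D.coeff μ (D.inv a) u w • D.c μ w v ∈ D.above μ := by
  have h0 : ∀ s t, D.inv (D.c μ s t) - D.c μ t s ∈ D.above μ := fun s t => D.inv_mem μ s t
  have h1 := D.inv_mem_above μ (D.c_mul_sub_mem μ v u (D.inv a))
  rw [map_sub, D.inv_mul, D.inv_inv, map_sum] at h1
  have h2 := D.mul_above_mem μ (h0 v u) a
  have h3 : ∑ w, D.coeff μ (D.inv a) u w • (D.inv (D.c μ v w) - D.c μ w v) ∈ D.above μ :=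
    Submodule.sum_mem _ fun w _ => Submodule.smul_mem _ _ (h0 v w)
  have h4 := Submodule.add_mem _ (Submodule.sub_mem _ h1 h2) h3
  convert h4 using 1
  simp only [map_smul, smul_sub, Finset.sum_sub_distrib, mul_sub]
  abel

/-- Both expansions of `c_{st} c_{uv}` agree. -/
theorem coeff_c (μ : D.Λ) (s t u v w w' : D.Idx μ) :
    (by classical exact if s = w then D.coeff μ (D.c μ u v) t w' else 0) =
      (by classical exact if v = w' then D.coeff μ (D.inv (D.c μ s t)) u w else 0 : R) := by
  have h := D.repr_of_mem_above (Submodule.sub_mem _ (D.c_mul_sub_mem μ s t (D.c μ u v))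
    (D.mul_c_sub_mem μ u v (D.c μ s t))) w w'
  have h1 := D.repr_sum_right μ s w w' (fun v' => D.coeff μ (D.c μ u v) t v')
  have h2 := D.repr_sum_left μ v w w' (fun v' => D.coeff μ (D.inv (D.c μ s t)) u v')
  rw [sub_sub_sub_cancel_left, map_sub, Finsupp.sub_apply, sub_eq_zero] at h
  rw [← h1, ← h2, h]

/-- The defining property of the bilinear form: `x · α_μ⁻¹(y^* ⊗ z) = ⟨x, y⟩ z`. -/
theorem act_tens (μ : D.Λ) (x y z : D.Cell μ) :
    D.act μ (D.tens μ y z) x = D.form μ x y • z := by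
  classical
  have key : ∀ t u v w, D.coeff μ (D.c μ u v) t w =
      if v = w then D.coeff μ (D.c μ u t) t t else 0 := by
    intro t u v w
    have h1 := D.coeff_c μ t t u v t w
    have h2 := D.coeff_c μ t t u t t t
    simp only [if_true] at h1 h2
    rw [h1, h2]
  have lin : ∀ t w, D.coeff μ (D.tens μ y z) t w =
      ∑ u, ∑ v, y u * z v * D.coeff μ (D.c μ u v) t w := by
    intro t w
    simp [coeff, tens, Finset.mul_sum, Finsupp.finsetSum_apply]
  ext w
  have e : ∀ t, D.coeff μ (D.tens μ y z) t w =
      ∑ u, y u * z w * D.coeff μ (D.c μ u t) t t := by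
    intro t
    rw [lin]
    refine Finset.sum_congr rfl fun u _ => ?_
    rw [Finset.sum_eq_single w]
    · rw [key t u w w, if_pos rfl]
    · intro v _ hv
      rw [key t u v w, if_neg hv, mul_zero]
    · simp
  change ∑ t, x t * D.coeff μ (D.tens μ y z) t w = D.form μ x y * z w
  rw [form, Finset.sum_mul]
  refine Finset.sum_congr rfl fun t _ => ?_
  rw [e, Finset.mul_sum, Finset.sum_mul]
  refine Finset.sum_congr rfl fun u _ => ?_
  ring

theorem tmul_mem_span (F : Type*) [CommRing F] [Algebra R F] (μ : D.Λ) {x : A}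
    (hx : x ∈ D.above μ) : (1 : F) ⊗ₜ[R] x ∈ Submodule.span F {x | ∃ (ν : D.Λ) (p q : D.Idx ν),
      μ < ν ∧ x = Algebra.TensorProduct.basis F D.basis ⟨ν, (p, q)⟩} := by
  induction hx using Submodule.span_induction with
  | mem x h =>
    obtain ⟨ν, p, q, h, rfl⟩ := h
    exact Submodule.subset_span ⟨ν, p, q, h, by simp [c]⟩
  | zero => simp
  | add x y _ _ hx hy => rw [TensorProduct.tmul_add]; exact Submodule.add_mem _ hx hy
  | smul r x _ hx =>
    rw [TensorProduct.tmul_smul, ← algebraMap_smul F r]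
    exact Submodule.smul_mem _ _ hx

/-- Extension of scalars: `F ⊗[R] A` with the cellular basis `1 ⊗ c_{st}`. Its cell module at `μ`
is `Idx μ → F`, the extension of scalars of the cell module of `A`. -/
abbrev baseChange (F : Type*) [CommRing F] [Algebra R F] : CellDatum F (F ⊗[R] A) where
  inv := D.inv.baseChange F
  inv_mul a b := by
    induction a using TensorProduct.induction_on with
    | zero => simp
    | add x y hx hy => rw [add_mul, map_add, hx, hy, map_add, mul_add]
    | tmul f a =>
      induction b using TensorProduct.induction_on with
      | zero => simp
      | add x y hx hy => rw [mul_add, map_add, hx, hy, map_add, add_mul]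
      | tmul g b =>
        rw [Algebra.TensorProduct.tmul_mul_tmul]
        simp only [LinearMap.baseChange_tmul]
        rw [Algebra.TensorProduct.tmul_mul_tmul, mul_comm f g]
        exact congrArg _ (D.inv_mul a b)
  inv_inv a := by
    induction a using TensorProduct.induction_on with
    | zero => simp
    | add x y hx hy => rw [map_add, map_add, hx, hy]
    | tmul f a =>
      simp only [LinearMap.baseChange_tmul]
      exact congrArg _ (D.inv_inv a)
  Λ := D.Λ
  Idx := D.Idx
  basis := Algebra.TensorProduct.basis F D.basis
  mul_mem μ t a := by
    induction a using TensorProduct.induction_on with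
    | zero => exact ⟨0, fun s => by simp⟩
    | add x y hx hy =>
      obtain ⟨r, hr⟩ := hx
      obtain ⟨r', hr'⟩ := hy
      refine ⟨r + r', fun s => ?_⟩
      convert Submodule.add_mem _ (hr s) (hr' s) using 1
      simp only [mul_add, Pi.add_apply, add_smul, Finset.sum_add_distrib]
      abel
    | tmul f a =>
      refine ⟨fun v => f * algebraMap R F (D.coeff μ a t v), fun s => ?_⟩
      have h := Submodule.smul_mem _ f (D.tmul_mem_span F μ (D.c_mul_sub_mem μ s t a))
      convert h using 1
      rw [TensorProduct.tmul_sub, TensorProduct.tmul_sum, smul_sub, Finset.smul_sum]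
      simp only [Algebra.TensorProduct.basis_apply, Algebra.TensorProduct.tmul_mul_tmul, one_mul,
        TensorProduct.smul_tmul', smul_eq_mul, mul_one, c]
      congr 1
      refine Finset.sum_congr rfl fun v _ => ?_
      rw [← TensorProduct.smul_tmul, Algebra.smul_def, mul_comm]
  inv_mem μ s t := by
    have h := D.tmul_mem_span F μ (D.inv_mem μ s t)
    convert h using 1
    simp [TensorProduct.tmul_sub]

end

end CellDatum

/-- An increasing sequence `A 0 ⊆ A 1 ⊆ ⋯` of cellular algebras with unital inclusions and
consistent involutions. -/
structure CellularTower.{u, v, w, w'} (R : Type u) (A : ℕ → Type v) [CommRing R] [∀ r, Ring (A r)]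
    [∀ r, Algebra R (A r)] where
  D : ∀ r, CellDatum.{u, v, w, w'} R (A r)
  ι : ∀ r, A r →ₐ[R] A (r + 1)
  ι_injective : ∀ r, Function.Injective (ι r)
  ι_inv : ∀ r a, ι r ((D r).inv a) = (D (r + 1)).inv (ι r a)

namespace CellularTower

section

variable {R : Type*} {A : ℕ → Type*} [CommRing R] [∀ r, Ring (A r)] [∀ r, Algebra R (A r)]
  (T : CellularTower R A)

/-- An order preserving cell filtration `0 = M 0 ⊆ M 1 ⊆ ⋯ ⊆ M length` of the restriction of the
cell module `Δ_{r+1}(μ)` to `A r`, with `label 0 ▷ label 1 ▷ ⋯`. The isomorphism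
`M (j+1) / M j ≅ Δ_r(label j)` is given as a surjective `A r`-linear map `proj j` on `M (j+1)`
whose kernel is `M j`. -/
structure CellFiltration {r : ℕ} (μ : (T.D (r + 1)).Λ) where
  length : ℕ
  M : Fin (length + 1) → Submodule R ((T.D (r + 1)).Cell μ)
  stable : ∀ i, ∀ x ∈ M i, ∀ a : A r, (T.D (r + 1)).act μ (T.ι r a) x ∈ M i
  mono : Monotone M
  bot : M 0 = ⊥
  top : M (Fin.last length) = ⊤
  label : Fin length → (T.D r).Λ
  label_anti : StrictAnti label
  proj : ∀ j : Fin length, M j.succ →ₗ[R] (T.D r).Cell (label j)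
  proj_surjective : ∀ j, Function.Surjective (proj j)
  proj_eq_zero : ∀ j (x : M j.succ), proj j x = 0 ↔ (x : (T.D (r + 1)).Cell μ) ∈ M j.castSucc
  proj_act : ∀ j (x : M j.succ) (a : A r),
    proj j ⟨(T.D (r + 1)).act μ (T.ι r a) x, stable _ _ x.2 a⟩ =
      (T.D r).act (label j) a (proj j x)

/-- There is an edge `ν → μ` in the branching diagram if `Δ_r(ν)` is a subquotient of an order
preserving cell filtration of the restriction of `Δ_{r+1}(μ)`. -/
def Edge {r : ℕ} (ν : (T.D r).Λ) (μ : (T.D (r + 1)).Λ) : Prop :=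
  ∃ (Φ : T.CellFiltration μ) (j : Fin Φ.length), Φ.label j = ν

/-- Standard tableaux of shape `μ` at level `r`: the directed paths in the branching diagram from
level `0` to `μ`. (`A 0 = R` forces level `0` to be a single vertex.) -/
inductive Path : (r : ℕ) → (T.D r).Λ → Type _
  | nil (μ : (T.D 0).Λ) : Path 0 μ
  | cons {r : ℕ} {ν : (T.D r).Λ} {μ : (T.D (r + 1)).Λ} (t : Path r ν) (e : T.Edge ν μ) :
      Path (r + 1) μ

instance finite_path (r : ℕ) (μ : (T.D r).Λ) : Finite (T.Path r μ) := by
  induction r with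
  | zero =>
    have : Function.Surjective (fun _ : Unit => Path.nil (T := T) μ) := by
      rintro ⟨_⟩; exact ⟨(), rfl⟩
    exact Finite.of_surjective _ this
  | succ r ih =>
    have : Function.Surjective (fun p : Σ ν : {ν : (T.D r).Λ // T.Edge ν μ}, T.Path r ν.1 =>
        Path.cons p.2 p.1.2) := by
      rintro (_ | @⟨_, ν, _, t, e⟩)
      exact ⟨⟨⟨ν, e⟩, t⟩, rfl⟩
    exact Finite.of_surjective _ this

instance fintypePath (r : ℕ) (μ : (T.D r).Λ) : Fintype (T.Path r μ) := Fintype.ofFinite _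

end

end CellularTower

/-- `B` is a split semisimple `F`-algebra: a finite product of matrix algebras over `F`. -/
def IsSplitSemisimple (F B : Type*) [Field F] [Ring B] [Algebra F B] : Prop :=
  ∃ (n : ℕ) (k : Fin n → ℕ), (∀ i, 0 < k i) ∧
    Nonempty (B ≃ₐ[F] ∀ i, Matrix (Fin (k i)) (Fin (k i)) F)

/-- A minimal central idempotent of the ring `B`. -/
def IsMinimalCentralIdempotent {B : Type*} [Ring B] (e : B) : Prop :=
  e ∈ Set.center B ∧ e * e = e ∧ e ≠ 0 ∧
    ∀ e' ∈ Set.center B, e' * e' = e' → e * e' = e' → e' = 0 ∨ e' = e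

/-- A sequence of diagram algebras over the integral domain `R` with field of fractions `F`,
together with the choices on which the Murphy bases depend: generators `δ μ` of the cell modules,
lifts `m μ` of `α_μ⁻¹((δ μ)^* ⊗ δ μ)`, an order preserving cell filtration of the restriction of
each cell module, and branching factors `d e`, one for each edge `e`. -/
structure DiagramTower.{u, u', v, w, w'} (R : Type u) (F : Type u') (A : ℕ → Type v) [CommRing R]
    [Field F] [Algebra R F] [∀ r, Ring (A r)] [∀ r, Algebra R (A r)] extends
    CellularTower.{u, v, w, w'} R A where
  /-- `A 0 = R`. -/
  zero_bijective : Function.Bijective (algebraMap R (A 0))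
  δ : ∀ {r : ℕ} (μ : (D r).Λ), (D r).Cell μ
  /-- The algebras are cyclic cellular: `δ μ` generates the cell module. -/
  cyclic : ∀ {r : ℕ} (μ : (D r).Λ) (x : (D r).Cell μ), ∃ a : A r, (D r).act μ a (δ μ) = x
  m : ∀ {r : ℕ} (_μ : (D r).Λ), A r
  m_sub_mem : ∀ {r : ℕ} (μ : (D r).Λ), m μ - (D r).tens μ (δ μ) (δ μ) ∈ (D r).above μ
  m_inv : ∀ {r : ℕ} (μ : (D r).Λ), (D r).inv (m μ) = m μ
  /-- The algebras become split semisimple over `F`. -/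
  split : ∀ r, IsSplitSemisimple F (F ⊗[R] A r)
  /-- Restriction-coherence. -/
  filtration : ∀ {r : ℕ} (μ : (D (r + 1)).Λ), toCellularTower.CellFiltration μ
  d : ∀ {r : ℕ} {ν : (D r).Λ} {μ : (D (r + 1)).Λ}, toCellularTower.Edge ν μ → A (r + 1)
  /-- For an edge `ν → μ`, with `ν` the `j`-th label of the filtration of `Δ_{r+1}(μ)`, the
  element `δ(μ) d_{ν → μ}` lies in the `j`-th step and its class corresponds to `δ(ν)`. -/
  d_spec : ∀ {r : ℕ} (μ : (D (r + 1)).Λ) (j : Fin (filtration μ).length)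
    (e : toCellularTower.Edge ((filtration μ).label j) μ),
    ∃ h : (D (r + 1)).act μ (d e) (δ μ) ∈ (filtration μ).M j.succ,
      (filtration μ).proj j ⟨_, h⟩ = δ ((filtration μ).label j)
  /-- Compatibility: `m_μ d_{ν → μ} = u^* m_ν` for some `u = u_{ν → μ}`. -/
  compat : ∀ {r : ℕ} {ν : (D r).Λ} {μ : (D (r + 1)).Λ} (e : toCellularTower.Edge ν μ),
    ∃ u : A (r + 1), m μ * d e = (D (r + 1)).inv u * ι r (m ν)

namespace DiagramTower

section

variable {R F : Type*} {A : ℕ → Type*} [CommRing R] [Field F] [Algebra R F] [∀ r, Ring (A r)]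
  [∀ r, Algebra R (A r)] (T : DiagramTower R F A)

/-- The cell datum of `F ⊗[R] A r`. -/
abbrev DF (r : ℕ) : CellDatum F (F ⊗[R] A r) := (T.D r).baseChange F

/-- The inclusion `F ⊗[R] A r → F ⊗[R] A (r + 1)`. -/
def ιF (r : ℕ) : F ⊗[R] A r →ₐ[F] F ⊗[R] A (r + 1) :=
  Algebra.TensorProduct.map (AlgHom.id F F) (T.ι r)

/-- `d_t = d_{t(r-1) → t(r)} ⋯ d_{t(0) → t(1)}`. -/
def pathFactor : {r : ℕ} → {μ : (T.D r).Λ} → T.Path r μ → A r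
  | _, _, .nil _ => 1
  | _, _, .cons (r := r) t e => T.d e * T.ι r (pathFactor t)

/-- The Murphy basis element `m^μ_{st} = d_s^* m_μ d_t` of `A r`. -/
def murphy {r : ℕ} {μ : (T.D r).Λ} (s t : T.Path r μ) : A r :=
  (T.D r).inv (T.pathFactor s) * T.m μ * T.pathFactor t

/-- The Murphy basis element `m_t = δ(μ) d_t` of the cell module of `A r`; it corresponds to the
class of `m_μ d_t` under the embedding `x ↦ α_μ⁻¹((δ μ)^* ⊗ x)` of `Δ_r(μ)`. -/
def murphyVec {r : ℕ} {μ : (T.D r).Λ} (t : T.Path r μ) : (T.D r).Cell μ :=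
  (T.D r).act μ (T.pathFactor t) (T.δ μ)

/-- The minimal central idempotent `z^μ_r` of `F ⊗[R] A r` attached to `μ`, that is, the one which
acts as the identity on the cell module of `F ⊗[R] A r` at `μ`. -/
def centralIdem {r : ℕ} (μ : (T.D r).Λ) : F ⊗[R] A r :=
  Classical.epsilon fun e =>
    IsMinimalCentralIdempotent e ∧ ∀ x : (T.DF r).Cell μ, (T.DF r).act μ e x = x

/-- The Gelfand-Zeitlin idempotent `F_t`, the product of the `z^{t(s)}_s` for `1 ≤ s ≤ r`. -/
def gz : {r : ℕ} → {μ : (T.D r).Λ} → T.Path r μ → F ⊗[R] A r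
  | _, _, .nil _ => 1
  | _, _, .cons (r := r) (μ := μ) t _ => T.ιF r (gz t) * T.centralIdem μ

/-- The seminormal vector `f^μ_t = m_t F_t`. -/
def f {r : ℕ} {μ : (T.D r).Λ} (t : T.Path r μ) : (T.DF r).Cell μ :=
  (T.DF r).act μ (T.gz t) fun i => algebraMap R F (T.murphyVec t i)

/-- The seminormal element `F^μ_{st} = F_s m^μ_{st} F_t`. -/
def Fel {r : ℕ} {μ : (T.D r).Λ} (s t : T.Path r μ) : F ⊗[R] A r :=
  T.gz s * (1 ⊗ₜ[R] T.murphy s t) * T.gz t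

/-- The bilinear form on the cell module of `F ⊗[R] A r` at `μ`. -/
def formF {r : ℕ} {μ : (T.D r).Λ} (x y : (T.DF r).Cell μ) : F := (T.DF r).form μ x y

/-- The normalized element `E^μ_{st} = ⟨f_s, f_s⟩⁻¹ F^μ_{st}`. -/
def Eel {r : ℕ} {μ : (T.D r).Λ} (s t : T.Path r μ) : F ⊗[R] A r :=
  (T.formF (T.f s) (T.f s))⁻¹ • T.Fel s t

end

end DiagramTower

end

/-! Everything is reduced to rank-one operators on cell modules. Contravariance of the form and
`act_tens` show that `F_{uv}` acts on its own cell module by `x ↦ ⟨x, f_u⟩ f_v` (`act_Fel`) and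
kills the others. All identities follow once three facts are known: the cell modules are jointly
faithful, the `f_t` form an orthogonal basis of each of them, and `⟨f_t, f_t⟩ ≠ 0`.

Faithfulness (`eq_of_coeff_eq`) comes from semisimplicity: the common annihilator of the cell
modules would contain an idempotent-like element that raises the support of every product. A
dimension count over labels `κ ≥ μ` then makes the forms nondegenerate (`eq_zero_of_form_eq_zero`),
and faithfulness with surjectivity identifies the central idempotents and shows that they are fixed
by the involution.

The `F_t` are pairwise orthogonal idempotents fixed by the involution, so the `f_t` are orthogonal.
They are nonzero because, by induction, `f_t` for a longer path maps to `f_t` for the truncated path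
in a filtration quotient (`f_ne_zero`). Hence they are independent; restriction along the tower
bounds the rank of a cell module by the number of paths, so they form a basis (`card_path`).
Nondegeneracy now forces `⟨f_t, f_t⟩ ≠ 0`. -/

noncomputable section

/-! ### Cell modules, contravariance and semisimple cellular algebras -/

namespace CellDatum

section

variable {R A : Type*} [CommRing R] [Ring A] [Algebra R A] (D : CellDatum R A)

theorem ext_of_vecMul {n : Type*} [Fintype n] {M N : Matrix n n R}
    (h : ∀ x : n → R, x ᵥ* M = x ᵥ* N) : M = N := by
  classical
  ext i j
  simpa using congrFun (h (Pi.single i 1)) j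

theorem coeff_mul (μ : D.Λ) (a b : A) : D.coeff μ (a * b) = D.coeff μ a * D.coeff μ b := by
  refine ext_of_vecMul fun x => ?_
  rw [← Matrix.vecMul_vecMul]
  exact D.act_mul μ a b x

theorem coeff_add (μ : D.Λ) (a b : A) : D.coeff μ (a + b) = D.coeff μ a + D.coeff μ b := by
  ext t v
  simp [coeff, mul_add]

theorem coeff_smul (μ : D.Λ) (r : R) (a : A) : D.coeff μ (r • a) = r • D.coeff μ a := by
  ext t v
  simp [coeff]

theorem coeff_of_mem_above {μ : D.Λ} {a : A} (ha : a ∈ D.above μ) : D.coeff μ a = 0 := by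
  ext t v
  exact D.repr_of_mem_above (D.mul_above_mem μ ha _) t v

/-- The matrix of the action on the cell module, as a linear map. -/
def coeffLin (μ : D.Λ) : A →ₗ[R] Matrix (D.Idx μ) (D.Idx μ) R where
  toFun := D.coeff μ
  map_add' := D.coeff_add μ
  map_smul' := D.coeff_smul μ

@[simp]
theorem coeffLin_apply (μ : D.Λ) (a : A) : D.coeffLin μ a = D.coeff μ a := rfl

theorem act_add_left (μ : D.Λ) (a b : A) (x : D.Cell μ) :
    D.act μ (a + b) x = D.act μ a x + D.act μ b x := by
  rw [act, coeff_add, Matrix.vecMul_add]; rfl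

theorem act_smul_left (μ : D.Λ) (r : R) (a : A) (x : D.Cell μ) :
    D.act μ (r • a) x = r • D.act μ a x := by
  rw [act, coeff_smul, Matrix.vecMul_smul]; rfl

theorem act_add (μ : D.Λ) (a : A) (x y : D.Cell μ) :
    D.act μ a (x + y) = D.act μ a x + D.act μ a y :=
  Matrix.add_vecMul _ _ _

theorem act_smul (μ : D.Λ) (a : A) (r : R) (x : D.Cell μ) :
    D.act μ a (r • x) = r • D.act μ a x :=
  Matrix.smul_vecMul _ _ _

theorem act_zero (μ : D.Λ) (a : A) : D.act μ a 0 = 0 := Matrix.zero_vecMul _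

theorem act_zero_left (μ : D.Λ) (x : D.Cell μ) : D.act μ 0 x = 0 := by
  rw [act, ← coeffLin_apply, map_zero, Matrix.vecMul_zero]

theorem sum_act (μ : D.Λ) {ι : Type*} (s : Finset ι) (a : ι → A) (x : D.Cell μ) :
    D.act μ (∑ i ∈ s, a i) x = ∑ i ∈ s, D.act μ (a i) x := by
  classical
  induction s using Finset.induction_on with
  | empty => rw [Finset.sum_empty, Finset.sum_empty, act_zero_left]
  | insert i s hi ih => rw [Finset.sum_insert hi, Finset.sum_insert hi, act_add_left, ih]

theorem inv_one : D.inv 1 = 1 := by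
  have h := D.inv_mul 1 (D.inv 1)
  rw [one_mul, D.inv_inv, one_mul] at h
  exact h.symm

/-- The action of `a` on the cell module as a linear map. -/
def actLin (μ : D.Λ) (a : A) : D.Cell μ →ₗ[R] D.Cell μ where
  toFun := D.act μ a
  map_add' := D.act_add μ a
  map_smul' := D.act_smul μ a

@[simp]
theorem actLin_apply (μ : D.Λ) (a : A) (x : D.Cell μ) : D.actLin μ a x = D.act μ a x := rfl

theorem act_sub_mem_above {μ : D.Λ} {a b : A} (h : a - b ∈ D.above μ) (x : D.Cell μ) :
    D.act μ a x = D.act μ b x := by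
  have h1 : D.coeff μ a = D.coeff μ b := by
    have := D.coeff_of_mem_above h
    rw [← coeffLin_apply, map_sub, sub_eq_zero] at this
    exact this
  rw [act, act, h1]

theorem form_add_right (μ : D.Λ) (x y z : D.Cell μ) :
    D.form μ x (y + z) = D.form μ x y + D.form μ x z := by
  simp [form, mul_add, add_mul, Finset.sum_add_distrib]

theorem form_smul_right (μ : D.Λ) (r : R) (x y : D.Cell μ) :
    D.form μ x (r • y) = r * D.form μ x y := by
  simp only [form, Finset.mul_sum, Pi.smul_apply, smul_eq_mul]
  refine Finset.sum_congr rfl fun _ _ => Finset.sum_congr rfl fun _ _ => ?_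
  ring

theorem form_add_left (μ : D.Λ) (x y z : D.Cell μ) :
    D.form μ (x + y) z = D.form μ x z + D.form μ y z := by
  simp [form, add_mul, Finset.sum_add_distrib]

theorem form_smul_left (μ : D.Λ) (r : R) (x y : D.Cell μ) :
    D.form μ (r • x) y = r * D.form μ x y := by
  simp only [form, Finset.mul_sum, Pi.smul_apply, smul_eq_mul]
  refine Finset.sum_congr rfl fun _ _ => Finset.sum_congr rfl fun _ _ => ?_
  ring

/-- The bilinear form with its first argument fixed. -/
def formLin (μ : D.Λ) (x : D.Cell μ) : D.Cell μ →ₗ[R] R where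
  toFun := D.form μ x
  map_add' := D.form_add_right μ x
  map_smul' r y := D.form_smul_right μ r x y

/-- Left multiplication by `a` reaches only the first tensor factor, through `a^*`. Together with
`act_tens` this gives contravariance of the form. -/
theorem mul_tens_sub_mem (μ : D.Λ) (a : A) (y z : D.Cell μ) :
    a * D.tens μ y z - D.tens μ (D.act μ (D.inv a) y) z ∈ D.above μ := by
  have h : ∑ s, ∑ t, (y s * z t) • (a * D.c μ s t - ∑ w, D.coeff μ (D.inv a) s w • D.c μ w t)
      ∈ D.above μ :=
    Submodule.sum_mem _ fun s _ => Submodule.sum_mem _ fun t _ =>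
      Submodule.smul_mem _ _ (D.mul_c_sub_mem μ s t a)
  convert h using 1
  simp only [smul_sub, Finset.sum_sub_distrib]
  congr 1
  · simp [tens, Finset.mul_sum]
  · simp only [tens, act, Matrix.vecMul, dotProduct, Finset.sum_mul, Finset.sum_smul,
      Finset.smul_sum, smul_smul]
    calc _ = ∑ w, ∑ s, ∑ t, (y s * D.coeff μ (D.inv a) s w * z t) • D.c μ w t :=
          Finset.sum_congr rfl fun w _ => Finset.sum_comm
      _ = ∑ s, ∑ w, ∑ t, (y s * D.coeff μ (D.inv a) s w * z t) • D.c μ w t := Finset.sum_comm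
      _ = ∑ s, ∑ t, ∑ w, (y s * D.coeff μ (D.inv a) s w * z t) • D.c μ w t :=
          Finset.sum_congr rfl fun w _ => Finset.sum_comm
      _ = _ := by
        refine Finset.sum_congr rfl fun _ _ => Finset.sum_congr rfl fun _ _ =>
          Finset.sum_congr rfl fun _ _ => ?_
        congr 1
        ring

/-- The bilinear form is contravariant. -/
theorem form_act (μ : D.Λ) (a : A) (x y : D.Cell μ) :
    D.form μ (D.act μ a x) y = D.form μ x (D.act μ (D.inv a) y) := by
  obtain ⟨i⟩ := D.nonemptyIdx μ
  -- The second tensor factor is the all-ones vector, so the scalar in front of it can be read off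
  -- at any coordinate.
  have h := D.act_sub_mem_above (D.mul_tens_sub_mem μ a y 1) x
  rw [act_mul, act_tens, act_tens] at h
  simpa using congrFun h i

theorem repr_c_of_ne {ν κ : D.Λ} (h : ν ≠ κ) (p q : D.Idx ν) (s t : D.Idx κ) :
    D.basis.repr (D.c ν p q) ⟨κ, (s, t)⟩ = 0 := by
  rw [c, Module.Basis.repr_self, Finsupp.single_eq_of_ne]
  exact fun e => h (congrArg Sigma.fst e).symm

theorem repr_of_mem_above_of_not_lt {ν κ : D.Λ} (h : ¬ ν < κ) {x : A} (hx : x ∈ D.above ν)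
    (s t : D.Idx κ) : D.basis.repr x ⟨κ, (s, t)⟩ = 0 := by
  induction hx using Submodule.span_induction with
  | mem x hx =>
    obtain ⟨ξ, p, q, h', rfl⟩ := hx
    exact D.repr_c_of_ne (fun e => h (h'.trans_eq e)) p q s t
  | zero => simp
  | add x y _ _ hx hy => simp [hx, hy]
  | smul a x _ hx => simp [hx]

/-- Expanding `c^κ_{tt} c^ν_{pq}` by the left multiplication rule for `c^ν` produces only labels `≥
ν`, and `κ` is not one of them. -/
theorem coeff_c_eq_zero {κ ν : D.Λ} (h : ¬ ν ≤ κ) (p q : D.Idx ν) : D.coeff κ (D.c ν p q) = 0 := by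
  ext t v
  change D.basis.repr (D.c κ t t * D.c ν p q) ⟨κ, (t, v)⟩ = 0
  have h2 := D.repr_of_mem_above_of_not_lt (fun h' => h h'.le) (D.mul_c_sub_mem ν p q (D.c κ t t))
    t v
  rw [map_sub, Finsupp.sub_apply, sub_eq_zero] at h2
  rw [h2, map_sum, Finsupp.finsetSum_apply]
  refine Finset.sum_eq_zero fun w _ => ?_
  rw [map_smul, Finsupp.smul_apply, D.repr_c_of_ne (fun e => h e.le), smul_zero]

/-- If `e` kills all cell modules, then `a * e` is supported strictly above the support of `a`. -/
theorem eq_zero_of_mul_eq_self {a e : A} (he : ∀ μ, D.coeff μ e = 0) (ha : a * e = a) :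
    a = 0 := by
  by_contra hne
  let S : Set D.Λ := {μ | ∃ p q, D.basis.repr a ⟨μ, (p, q)⟩ ≠ 0}
  have hS : S.Nonempty := by
    by_contra hS
    rw [Set.not_nonempty_iff_eq_empty, Set.eq_empty_iff_forall_notMem] at hS
    apply hne
    refine D.basis.ext_elem fun ⟨μ, p, q⟩ => ?_
    by_contra hc
    exact hS μ ⟨p, q, by simpa using hc⟩
  -- Since `a = a * e`, a label of the support lies strictly above another label of the support; a
  -- minimal one cannot.
  obtain ⟨μ, ⟨p, q, hpq⟩, hmin⟩ := S.toFinite.exists_minimal hS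
  apply hpq
  rw [← ha]
  conv_lhs => rw [← D.basis.sum_repr a]
  rw [Finset.sum_mul, map_sum, Finsupp.finsetSum_apply]
  refine Finset.sum_eq_zero fun ⟨ν, s, t⟩ _ => ?_
  rw [smul_mul_assoc, map_smul, Finsupp.smul_apply, smul_eq_mul]
  by_cases h0 : D.basis.repr a ⟨ν, (s, t)⟩ = 0
  · rw [h0, zero_mul]
  have hν : ν ∈ S := ⟨s, t, h0⟩
  have h1 := D.c_mul_sub_mem ν s t e
  simp only [he, Matrix.zero_apply, zero_smul, Finset.sum_const_zero, sub_zero] at h1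
  have h3 := D.repr_of_mem_above_of_not_lt
    (fun h' : ν < μ => absurd (hmin hν h'.le) h'.not_ge) h1 p q
  rw [c] at h3
  rw [h3, mul_zero]

/-- The common annihilator `K` of the cell modules has a complementary left ideal `K'`. Writing `1 =
e + e'` accordingly, any `x ∈ K` satisfies `x e' ∈ K ∩ K' = 0`, so `x = x e` with `e` killing all
cell modules, and the support argument gives `x = 0`. -/
theorem eq_of_coeff_eq [IsSemisimpleRing A] {a b : A} (h : ∀ μ, D.coeff μ a = D.coeff μ b) :
    a = b := by
  let K : Submodule A A :=
    { carrier := {x | ∀ μ, D.coeff μ x = 0}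
      zero_mem' := fun μ => (D.coeffLin μ).map_zero
      add_mem' := fun hx hy μ => by rw [coeff_add, hx μ, hy μ, add_zero]
      smul_mem' := fun a x hx μ => by rw [smul_eq_mul, coeff_mul, hx μ, mul_zero] }
  obtain ⟨K', hK⟩ := exists_isCompl K
  have h1 : (1 : A) ∈ K ⊔ K' := by rw [hK.sup_eq_top]; trivial
  obtain ⟨e, he, e', he', hee⟩ := Submodule.mem_sup.1 h1
  have hab : a - b ∈ K := fun μ => by
    rw [← coeffLin_apply, map_sub, coeffLin_apply, coeffLin_apply, h μ, sub_self]
  have h2 : (a - b) * e' ∈ K ⊓ K' := by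
    refine ⟨?_, K'.smul_mem _ he'⟩
    have : (a - b) * e' = (a - b) - (a - b) * e := by
      rw [eq_sub_iff_add_eq, add_comm, ← mul_add, hee, mul_one]
    rw [this]
    exact K.sub_mem hab (K.smul_mem _ he)
  rw [hK.inf_eq_bot, Submodule.mem_bot] at h2
  have h3 : (a - b) * e = a - b := by
    conv_rhs => rw [← mul_one (a - b), ← hee, mul_add, h2, add_zero]
  exact sub_eq_zero.1 (D.eq_zero_of_mul_eq_self he h3)

end

section Field

variable {F B : Type*} [Field F] [Ring B] [Algebra F B] (D : CellDatum F B)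

theorem finrank_eq : Module.finrank F B = ∑ μ, Fintype.card (D.Idx μ) * Fintype.card (D.Idx μ) := by
  rw [Module.finrank_eq_card_basis D.basis, Fintype.card_sigma]
  simp

/-- A semisimple cellular algebra acts on its cell modules by arbitrary matrices. -/
theorem exists_coeff_eq [IsSemisimpleRing B] (M : ∀ μ, Matrix (D.Idx μ) (D.Idx μ) F) :
    ∃ a, ∀ μ, D.coeff μ a = M μ := by
  let φ : B →ₗ[F] ∀ μ, Matrix (D.Idx μ) (D.Idx μ) F := LinearMap.pi D.coeffLin
  have hinj : Function.Injective φ := fun a b h => D.eq_of_coeff_eq fun μ => congrFun h μ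
  have := Module.Finite.of_basis D.basis
  have hsurj := (LinearMap.injective_iff_surjective_of_finrank_eq_finrank (f := φ) (by
    rw [D.finrank_eq, Module.finrank_pi_fintype]
    simp [Module.finrank_matrix])).1 hinj
  obtain ⟨a, ha⟩ := hsurj M
  exact ⟨a, fun μ => congrFun ha μ⟩

/-- In a semisimple cellular algebra the bilinear forms are nondegenerate. -/
theorem eq_zero_of_form_eq_zero [IsSemisimpleRing B] {μ : D.Λ} {x : D.Cell μ}
    (hx : ∀ y, D.form μ x y = 0) : x = 0 := by
  classical
  -- The span of the `c^κ` with `κ ≥ μ` acts as zero on the cell modules with other labels. It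
  -- therefore embeds in, and by dimension equals, the product of the matrix algebras over `κ ≥ μ`.
  let I := Σ κ : {κ : D.Λ // μ ≤ κ}, D.Idx κ.1 × D.Idx κ.1
  let toB : (I → F) →ₗ[F] B := Fintype.linearCombination F fun i : I => D.c i.1.1 i.2.1 i.2.2
  have htoB : Function.Injective toB := by
    have : LinearIndependent F fun i : I => D.c i.1.1 i.2.1 i.2.2 := by
      refine D.basis.linearIndependent.comp
        (fun i : I => (⟨i.1.1, i.2⟩ : Σ κ, D.Idx κ × D.Idx κ)) ?_
      rintro ⟨⟨κ, hκ⟩, p⟩ ⟨⟨ξ, hξ⟩, q⟩ h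
      obtain ⟨rfl, h⟩ := Sigma.mk.inj_iff.1 h
      rw [heq_eq_eq] at h
      rw [show p = q from h]
    exact linearIndependent_iff_injective_fintypeLinearCombination.1 this
  let φ : (I → F) →ₗ[F] ∀ κ : {κ : D.Λ // μ ≤ κ}, Matrix (D.Idx κ.1) (D.Idx κ.1) F :=
    LinearMap.pi fun κ => D.coeffLin κ.1 ∘ₗ toB
  have hzero : ∀ w κ, ¬ μ ≤ κ → D.coeff κ (toB w) = 0 := by
    intro w κ hκ
    rw [← coeffLin_apply]
    simp only [toB, Fintype.linearCombination_apply, map_sum, map_smul, coeffLin_apply]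
    exact Finset.sum_eq_zero fun i _ => by
      rw [D.coeff_c_eq_zero (fun h => hκ (i.1.2.trans h)), smul_zero]
  have hinj : Function.Injective φ := by
    intro w w' h
    refine htoB (D.eq_of_coeff_eq fun κ => ?_)
    by_cases hκ : μ ≤ κ
    · exact congrFun h ⟨κ, hκ⟩
    · rw [hzero w κ hκ, hzero w' κ hκ]
  have hsurj := (LinearMap.injective_iff_surjective_of_finrank_eq_finrank (f := φ) (by
    rw [Module.finrank_fintype_fun_eq_card, Module.finrank_pi_fintype, Fintype.card_sigma]
    simp [Module.finrank_matrix])).1 hinj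
  -- This combination acts as the identity on the cell module at `μ`, yet each of its terms kills
  -- `x`: those with label `μ` because `x` is in the radical of the form, those strictly above
  -- because they kill the whole module.
  obtain ⟨w, hw⟩ := hsurj 1
  have h1 : D.coeff μ (toB w) = 1 := congrFun hw ⟨μ, le_rfl⟩
  have h2 : ∀ i : I, D.act μ (D.c i.1.1 i.2.1 i.2.2) x = 0 := by
    rintro ⟨⟨κ, hκ⟩, p, q⟩
    by_cases h : κ = μ
    · subst h
      have : D.c κ p q = D.tens κ (Pi.single p 1) (Pi.single q 1) := by
        simp [tens, Pi.single_apply]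
      dsimp only
      rw [this, act_tens, hx, zero_smul]
    · dsimp only
      rw [act, D.coeff_c_eq_zero (fun h' => h (le_antisymm h' hκ)), Matrix.vecMul_zero]
  have h3 : D.act μ (toB w) x = 0 := by
    simp only [toB, Fintype.linearCombination_apply, sum_act, act_smul_left, h2, smul_zero,
      Finset.sum_const_zero]
  rwa [act, h1, Matrix.vecMul_one] at h3

/-- The central idempotent of a semisimple cellular algebra that acts as the identity on the cell
module at `μ` and as zero on the others. -/
theorem exists_central_idempotent [IsSemisimpleRing B] (μ : D.Λ) :
    ∃ z : B, D.coeff μ z = (by classical exact 1) ∧ (∀ κ, κ ≠ μ → D.coeff κ z = 0) ∧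
      z ∈ Set.center B ∧ D.inv z = z ∧ ∀ e, (IsMinimalCentralIdempotent e ∧
        ∀ x, D.act μ e x = x) ↔ e = z := by
  classical
  -- By faithfulness each property of `z` can be tested on the cell modules, where `z` is the
  -- identity or zero.
  obtain ⟨z, hz⟩ := D.exists_coeff_eq (Pi.single μ 1)
  have hz1 : D.coeff μ z = 1 := by rw [hz]; simp
  have hz0 : ∀ κ, κ ≠ μ → D.coeff κ z = 0 := fun κ h => by rw [hz, Pi.single_eq_of_ne h]
  have hcomm : ∀ a, z * a = a * z := fun a => D.eq_of_coeff_eq fun κ => by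
    rw [coeff_mul, coeff_mul]
    by_cases h : κ = μ
    · subst h; rw [hz1, one_mul, mul_one]
    · rw [hz0 κ h, zero_mul, mul_zero]
  have hcen : z ∈ Set.center B := Semigroup.mem_center_iff.2 fun a => (hcomm a).symm
  have hidem : z * z = z := D.eq_of_coeff_eq fun κ => by
    rw [coeff_mul]
    by_cases h : κ = μ
    · subst h; rw [hz1, one_mul]
    · rw [hz0 κ h, zero_mul]
  -- By contravariance `x z^* - x z` is orthogonal to every vector, so nondegeneracy applies.
  have hinv : D.inv z = z := D.eq_of_coeff_eq fun κ => ext_of_vecMul fun x => by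
    change D.act κ _ x = D.act κ _ x
    rw [← sub_eq_zero]
    refine D.eq_zero_of_form_eq_zero fun y => ?_
    rw [sub_eq_add_neg, ← neg_one_smul F, form_add_left, form_smul_left, form_act, inv_inv]
    by_cases h : κ = μ
    · subst h; simp [act, hz1]
    · simp [act, hz0 κ h, form]
  have hne : ∀ e, (∀ x, D.act μ e x = x) → D.coeff μ e = 1 := fun e he =>
    ext_of_vecMul fun x => (he x).trans (Matrix.vecMul_one x).symm
  have hzne : z ≠ 0 := by
    rintro rfl
    have : D.coeff μ 0 = 0 := (D.coeffLin μ).map_zero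
    rw [this] at hz1
    exact zero_ne_one hz1
  have hmin : ∀ e ∈ Set.center B, e * e = e → z * e = e → e = 0 ∨ e = z := by
    intro e hec hee hze
    -- Every matrix occurs as an action, so a central element acts by a scalar, and an idempotent
    -- scalar is `0` or `1`.
    have hc : D.coeff μ e ∈ Set.center (Matrix (D.Idx μ) (D.Idx μ) F) := by
      refine Semigroup.mem_center_iff.2 fun M => ?_
      obtain ⟨a, ha⟩ := D.exists_coeff_eq (Pi.single μ M)
      have ha : D.coeff μ a = M := by rw [ha]; simp
      rw [← ha, ← coeff_mul, ← coeff_mul, Semigroup.mem_center_iff.1 hec]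
    have he0 : ∀ κ, κ ≠ μ → D.coeff κ e = 0 := fun κ h => by
      rw [← hze, coeff_mul, hz0 κ h, zero_mul]
    obtain ⟨r, hr⟩ : ∃ r : F, D.coeff μ e = r • 1 := by
      rw [Matrix.center_eq_range] at hc
      obtain ⟨r, hr⟩ := hc
      exact ⟨r, by rw [← hr, Matrix.scalar_apply, Matrix.smul_one_eq_diagonal]⟩
    have hr2 : r * r = r := by
      have := D.coeff_mul μ e e
      rw [hee, hr] at this
      obtain ⟨i⟩ := D.nonemptyIdx μ
      simpa using (congrFun (congrFun this i) i).symm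
    rcases IsIdempotentElem.iff_eq_zero_or_one.1 hr2 with rfl | rfl
    · left
      refine D.eq_of_coeff_eq fun κ => ?_
      rw [← coeffLin_apply _ _ 0, map_zero]
      by_cases h : κ = μ
      · subst h; rw [hr, zero_smul]
      · exact he0 κ h
    · right
      refine D.eq_of_coeff_eq fun κ => ?_
      by_cases h : κ = μ
      · subst h; rw [hr, one_smul, hz1]
      · rw [he0 κ h, hz0 κ h]
  refine ⟨z, hz1, hz0, hcen, hinv, fun e => ⟨?_, ?_⟩⟩
  · rintro ⟨⟨hec, hee, -, hemin⟩, hact⟩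
    have h1 := hne e hact
    have hez : e * z = z := D.eq_of_coeff_eq fun κ => by
      rw [coeff_mul]
      by_cases h : κ = μ
      · subst h; rw [h1, one_mul]
      · rw [hz0 κ h, mul_zero]
    exact ((hemin z hcen hidem hez).resolve_left hzne).symm
  · rintro rfl
    exact ⟨⟨hcen, hidem, hzne, hmin⟩, fun x => by rw [act, hz1, Matrix.vecMul_one]⟩

end Field

end CellDatum

theorem IsSplitSemisimple.isSemisimpleRing {F B : Type*} [Field F] [Ring B] [Algebra F B]
    (h : IsSplitSemisimple F B) : IsSemisimpleRing B := by
  obtain ⟨n, k, -, ⟨e⟩⟩ := h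
  exact e.symm.toRingEquiv.isSemisimpleRing

end

/-! ### Clearing denominators and extension of scalars -/

noncomputable section

set_option linter.unusedSectionVars false

theorem exists_smul_eq_one_tmul {R F A : Type*} [CommRing R] [IsDomain R] [Field F] [Algebra R F]
    [IsFractionRing R F] [Ring A] [Algebra R A] (x : F ⊗[R] A) :
    ∃ b : R, b ≠ 0 ∧ ∃ a : A, algebraMap R F b • x = 1 ⊗ₜ[R] a := by
  induction x using TensorProduct.induction_on with
  | zero => exact ⟨1, one_ne_zero, 0, by simp⟩
  | tmul f a =>
    obtain ⟨n, d, hd, rfl⟩ := IsFractionRing.div_surjective (A := R) f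
    have hd := nonZeroDivisors.ne_zero hd
    refine ⟨d, hd, n • a, ?_⟩
    have hd' : algebraMap R F d ≠ 0 := by simpa using hd
    rw [TensorProduct.smul_tmul', smul_eq_mul, mul_div_cancel₀ _ hd', ← TensorProduct.smul_tmul,
      Algebra.smul_def, mul_one]
  | add x y hx hy =>
    obtain ⟨b, hb, a, ha⟩ := hx
    obtain ⟨b', hb', a', ha'⟩ := hy
    refine ⟨b * b', mul_ne_zero hb hb', b' • a + b • a', ?_⟩
    rw [smul_add, map_mul, mul_comm, mul_smul, ha, mul_comm, mul_smul, ha', TensorProduct.tmul_add,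
      TensorProduct.tmul_smul, TensorProduct.tmul_smul, algebraMap_smul, algebraMap_smul]

namespace CellDatum

section

variable {R A : Type*} [CommRing R] [Ring A] [Algebra R A] (D : CellDatum R A)
  (F : Type*) [CommRing F] [Algebra R F]

/-- Extension of scalars of a vector of the cell module. -/
def mapCell {μ : D.Λ} (x : D.Cell μ) : (D.baseChange F).Cell μ := fun i => algebraMap R F (x i)

theorem coeff_baseChange (μ : D.Λ) (a : A) :
    (D.baseChange F).coeff μ (1 ⊗ₜ[R] a) = (D.coeff μ a).map (algebraMap R F) := by
  ext t v
  change (Algebra.TensorProduct.basis F D.basis).repr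
    (Algebra.TensorProduct.basis F D.basis ⟨μ, (t, t)⟩ * (1 ⊗ₜ[R] a)) ⟨μ, (t, v)⟩ = _
  rw [Algebra.TensorProduct.basis_apply, Algebra.TensorProduct.tmul_mul_tmul, one_mul,
    Algebra.TensorProduct.basis_repr_tmul]
  simp [coeff, c]

theorem act_baseChange (μ : D.Λ) (a : A) (x : D.Cell μ) :
    (D.baseChange F).act μ (1 ⊗ₜ[R] a) (D.mapCell F x) = D.mapCell F (D.act μ a x) := by
  rw [act, coeff_baseChange]
  ext i
  exact ((algebraMap R F).map_vecMul (D.coeff μ a) x i).symm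

theorem tens_baseChange (μ : D.Λ) (x y : D.Cell μ) :
    (D.baseChange F).tens μ (D.mapCell F x) (D.mapCell F y) = 1 ⊗ₜ[R] D.tens μ x y := by
  simp only [tens, TensorProduct.tmul_sum]
  refine Finset.sum_congr rfl fun s _ => Finset.sum_congr rfl fun t _ => ?_
  rw [TensorProduct.tmul_smul, ← algebraMap_smul F (x s * y t), map_mul]
  congr 1
  exact Algebra.TensorProduct.basis_apply D.basis _

theorem mapCell_injective [FaithfulSMul R F] (μ : D.Λ) :
    Function.Injective (D.mapCell F (μ := μ)) := fun _ _ h =>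
  funext fun i => FaithfulSMul.algebraMap_injective R F (congrFun h i)

theorem mapCell_smul {μ : D.Λ} (r : R) (x : D.Cell μ) :
    D.mapCell F (r • x) = algebraMap R F r • D.mapCell F x :=
  funext fun _ => map_mul _ _ _

theorem mapCell_zero {μ : D.Λ} : D.mapCell F (0 : D.Cell μ) = 0 :=
  funext fun _ => map_zero _

end

end CellDatum

/-! ### Cell filtrations: labels and ranks -/

namespace CellularTower

section

variable {R : Type*} {A : ℕ → Type*} [CommRing R] [IsDomain R] [∀ r, Ring (A r)]
  [∀ r, Algebra R (A r)] {T : CellularTower R A} {r : ℕ} {μ : (T.D (r + 1)).Λ}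

namespace CellFiltration

variable (Φ : T.CellFiltration μ)

/-- Each application of `a` descends one step of the filtration, since `a` is zero on the
subquotients. -/
theorem act_pow_eq_zero {a : A r} (ha : ∀ j x, (T.D r).act (Φ.label j) a x = 0)
    (i : Fin (Φ.length + 1)) : ∀ x ∈ Φ.M i, (T.D (r + 1)).act μ (T.ι r (a ^ (i : ℕ))) x = 0 := by
  induction i using Fin.induction with
  | zero =>
    intro x hx
    rw [Φ.bot, Submodule.mem_bot] at hx
    rw [hx, CellDatum.act_zero]
  | succ i ih =>
    intro x hx
    rw [Fin.val_succ, pow_succ', map_mul, CellDatum.act_mul]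
    exact ih _ ((Φ.proj_eq_zero i ⟨_, Φ.stable _ _ hx a⟩).1
      ((Φ.proj_act i ⟨x, hx⟩ a).trans (ha i _)))

/-- If `Φ` missed the label, `a` would be nilpotent on the whole module, whereas on a subquotient of
`Ψ` its powers are the nonzero scalars `b ^ n`. So the edges do not depend on the filtration as soon
as such an `a` exists. -/
theorem exists_label_eq (Ψ : T.CellFiltration μ) (j : Fin Ψ.length) {a : A r} {b : R} (hb : b ≠ 0)
    (h1 : ∀ x, (T.D r).act (Ψ.label j) a x = b • x)
    (h0 : ∀ κ, κ ≠ Ψ.label j → ∀ x, (T.D r).act κ a x = 0) : ∃ i, Φ.label i = Ψ.label j := by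
  by_contra! hne
  obtain ⟨x, hx⟩ := Ψ.proj_surjective j 1
  have hpow : ∀ n y, (T.D r).act (Ψ.label j) (a ^ n) y = b ^ n • y := by
    intro n
    induction n with
    | zero => intro y; rw [pow_zero, pow_zero, CellDatum.act_one, one_smul]
    | succ n ih => intro y; rw [pow_succ, CellDatum.act_mul, ih, h1, smul_smul, pow_succ']
  have h2 := Φ.act_pow_eq_zero (fun i x => h0 _ (hne i) x) (Fin.last _) x (by
    rw [Φ.top]; trivial)
  have h3 := Ψ.proj_act j x (a ^ (Fin.last Φ.length : ℕ))
  rw [hpow, hx, (Ψ.proj_eq_zero j _).2 (by simp only [h2]; exact Submodule.zero_mem _)] at h3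
  obtain ⟨i⟩ := (T.D r).nonemptyIdx (Ψ.label j)
  have h4 := congrFun h3 i
  simp only [Pi.zero_apply, Pi.smul_apply, Pi.one_apply, smul_eq_mul, mul_one] at h4
  exact pow_ne_zero _ hb h4.symm

/-- Rank-nullity over the domain `R` for `proj i`, whose kernel embeds in the previous step. -/
theorem rank_le (i : Fin (Φ.length + 1)) : Module.rank R (Φ.M i) ≤
    ((∑ j : Fin Φ.length with j.castSucc < i, Fintype.card ((T.D r).Idx (Φ.label j)) : ℕ) :
      Cardinal) := by
  induction i using Fin.induction with
  | zero => rw [Φ.bot]; simp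
  | succ i ih =>
    have h1 := (LinearMap.rank_range_add_rank_ker (Φ.proj i)).symm
    rw [LinearMap.range_eq_top.2 (Φ.proj_surjective i), rank_top, rank_fun'] at h1
    let g : LinearMap.ker (Φ.proj i) →ₗ[R] Φ.M i.castSucc :=
      ((Φ.M i.succ).subtype ∘ₗ (LinearMap.ker (Φ.proj i)).subtype).codRestrict _
        fun x => (Φ.proj_eq_zero i x.1).1 x.2
    have h2 := LinearMap.rank_le_of_injective g (fun x y h =>
      Subtype.ext (Subtype.ext (show (g x).1 = (g y).1 by rw [h])))
    have h3 : (Finset.univ.filter fun j : Fin Φ.length => j.castSucc < i.succ) =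
        insert i (Finset.univ.filter fun j : Fin Φ.length => j.castSucc < i.castSucc) := by
      ext j
      simp only [Finset.mem_filter, Finset.mem_univ, true_and, Finset.mem_insert]
      rw [Fin.castSucc_lt_castSucc_iff, Fin.castSucc_lt_succ_iff, le_iff_eq_or_lt]
    rw [h1, h3, Finset.sum_insert (by simp), Nat.cast_add]
    exact add_le_add_right (h2.trans ih) _

theorem card_idx_le : Fintype.card ((T.D (r + 1)).Idx μ) ≤
    ∑ j, Fintype.card ((T.D r).Idx (Φ.label j)) := by
  have h := Φ.rank_le (Fin.last _)
  rw [Φ.top, rank_top, rank_fun', Nat.cast_le] at h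
  simpa [Fin.castSucc_lt_last] using h

end CellFiltration

/-- Strict monotonicity makes the labels distinct, so extending paths from them to `μ` is injective.
-/
theorem card_sum_path_le (Φ : T.CellFiltration μ) :
    ∑ j, Fintype.card (T.Path r (Φ.label j)) ≤ Fintype.card (T.Path (r + 1) μ) := by
  rw [← Fintype.card_sigma]
  refine Fintype.card_le_of_injective
    (fun p : Σ j, T.Path r (Φ.label j) => Path.cons p.2 ⟨Φ, p.1, rfl⟩) ?_
  rintro ⟨j, t⟩ ⟨k, u⟩ h
  obtain ⟨h1, h2⟩ := (Path.cons.injEq ..).mp h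
  obtain rfl := Φ.label_anti.injective h1
  exact Sigma.ext rfl h2

end

end CellularTower

/-! ### Central idempotents and paths in the diagram tower -/

namespace DiagramTower

section

variable {R F : Type*} {A : ℕ → Type*} [CommRing R] [IsDomain R] [Field F]
    [Algebra R F] [IsFractionRing R F] [∀ r, Ring (A r)] [∀ r, Algebra R (A r)]
    (T : DiagramTower R F A)

theorem sum_card_zero :
    ∑ μ : (T.D 0).Λ, Fintype.card ((T.D 0).Idx μ) * Fintype.card ((T.D 0).Idx μ) = 1 := by
  have h := (LinearEquiv.ofBijective (Algebra.linearMap R (A 0)) T.zero_bijective).finrank_eq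
  rw [Module.finrank_self, Module.finrank_eq_card_basis (T.D 0).basis, Fintype.card_sigma] at h
  simpa using h.symm

theorem card_zero : Fintype.card (T.D 0).Λ ≤ 1 := by
  rw [← T.sum_card_zero, ← Finset.card_univ, Finset.card_eq_sum_ones]
  exact Finset.sum_le_sum fun μ _ => Nat.mul_pos Fintype.card_pos Fintype.card_pos

theorem subsingleton_zero : Subsingleton (T.D 0).Λ :=
  Fintype.card_le_one_iff_subsingleton.1 T.card_zero

theorem card_idx_zero (μ : (T.D 0).Λ) : Fintype.card ((T.D 0).Idx μ) ≤ 1 := by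
  have h := Finset.single_le_sum
    (f := fun μ : (T.D 0).Λ => Fintype.card ((T.D 0).Idx μ) * Fintype.card ((T.D 0).Idx μ))
    (fun _ _ => Nat.zero_le _) (Finset.mem_univ μ)
  rw [T.sum_card_zero] at h
  exact (Nat.le_mul_self _).trans h

theorem card_idx_le_card_path {r : ℕ} (μ : (T.D r).Λ) :
    Fintype.card ((T.D r).Idx μ) ≤ Fintype.card (T.Path r μ) := by
  induction r with
  | zero =>
    have : Nonempty (T.Path 0 μ) := ⟨.nil μ⟩
    exact (T.card_idx_zero μ).trans Fintype.card_pos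
  | succ r ih =>
    exact (T.filtration μ).card_idx_le.trans ((Finset.sum_le_sum fun j _ => ih _).trans
      (CellularTower.card_sum_path_le _))

theorem isSemisimpleRing (T : DiagramTower R F A) (r : ℕ) : IsSemisimpleRing (F ⊗[R] A r) :=
  (T.split r).isSemisimpleRing

theorem δ_ne_zero {r : ℕ} (μ : (T.D r).Λ) : T.δ μ ≠ 0 := by
  intro h
  obtain ⟨a, ha⟩ := T.cyclic μ 1
  rw [h, CellDatum.act_zero] at ha
  obtain ⟨i⟩ := (T.D r).nonemptyIdx μ
  exact zero_ne_one (congrFun ha i)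

/-- Uniqueness in `exists_central_idempotent` pins down the `Classical.epsilon` choice. -/
theorem centralIdem_spec {r : ℕ} (μ : (T.D r).Λ) :
    (∀ x, (T.DF r).act μ (T.centralIdem μ) x = x) ∧
    (∀ κ, κ ≠ μ → ∀ x, (T.DF r).act κ (T.centralIdem μ) x = 0) ∧
    (∀ a, T.centralIdem μ * a = a * T.centralIdem μ) ∧
    (T.DF r).inv (T.centralIdem μ) = T.centralIdem μ := by
  classical
  have := T.isSemisimpleRing r
  obtain ⟨z, h1, h0, hc, hi, hu⟩ := (T.DF r).exists_central_idempotent μ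
  have hz : T.centralIdem μ = z := (hu _).1 (Classical.epsilon_spec (p := fun e =>
    IsMinimalCentralIdempotent e ∧ ∀ x : (T.DF r).Cell μ, (T.DF r).act μ e x = x)
    ⟨z, (hu z).2 rfl⟩)
  rw [hz]
  refine ⟨fun x => ?_, fun κ hκ x => ?_, fun a => (Semigroup.mem_center_iff.1 hc a).symm, hi⟩
  · rw [CellDatum.act, h1]
    exact Matrix.vecMul_one x
  · rw [CellDatum.act, h0 κ hκ, Matrix.vecMul_zero]

variable {T} in
theorem ext_act {r : ℕ} {a b : F ⊗[R] A r} (h : ∀ μ x, (T.DF r).act μ a x = (T.DF r).act μ b x) :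
    a = b :=
  have := T.isSemisimpleRing r
  (T.DF r).eq_of_coeff_eq fun μ => CellDatum.ext_of_vecMul (h μ)

theorem centralIdem_mul_self {r : ℕ} (μ : (T.D r).Λ) :
    T.centralIdem μ * T.centralIdem μ = T.centralIdem μ := ext_act (T := T) fun κ x => by
  rw [CellDatum.act_mul]
  by_cases h : κ = μ
  · subst h; rw [(T.centralIdem_spec κ).1, (T.centralIdem_spec κ).1]
  · rw [(T.centralIdem_spec μ).2.1 κ h, (T.centralIdem_spec μ).2.1 κ h]

theorem centralIdem_mul_of_ne {r : ℕ} {μ ν : (T.D r).Λ} (hne : μ ≠ ν) :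
    T.centralIdem μ * T.centralIdem ν = 0 := ext_act (T := T) fun κ x => by
  rw [CellDatum.act_mul]
  rw [CellDatum.act_zero_left]
  by_cases h : κ = μ
  · subst h; rw [(T.centralIdem_spec ν).2.1 κ hne]
  · rw [(T.centralIdem_spec μ).2.1 κ h, CellDatum.act_zero]

/-- Every edge of the branching diagram is visible in the chosen filtration. -/
theorem exists_label_eq {r : ℕ} {ν : (T.D r).Λ} {μ : (T.D (r + 1)).Λ} (e : T.Edge ν μ) :
    ∃ j, (T.filtration μ).label j = ν := by
  obtain ⟨Ψ, j, rfl⟩ := e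
  -- The multiple `b z` of the central idempotent comes from some `a` in `A r`, which acts by `b` at
  -- this label and by zero at the others.
  obtain ⟨b, hb, a, ha⟩ := exists_smul_eq_one_tmul (T.centralIdem (Ψ.label j))
  have hinj := fun κ => (T.D r).mapCell_injective F κ
  refine (T.filtration μ).exists_label_eq Ψ j (a := a) hb (fun x => hinj _ ?_)
    fun κ hκ x => hinj _ ?_
  · rw [← CellDatum.act_baseChange, ← ha, CellDatum.act_smul_left, CellDatum.mapCell_smul]
    congr 1
    exact (T.centralIdem_spec _).1 _
  · rw [← CellDatum.act_baseChange, ← ha, CellDatum.act_smul_left, CellDatum.mapCell_zero]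
    erw [(T.centralIdem_spec _).2.1 κ hκ]
    exact smul_zero _

theorem ιF_tmul (r : ℕ) (a : A r) : T.ιF r (1 ⊗ₜ[R] a) = 1 ⊗ₜ[R] T.ι r a := rfl

theorem inv_ιF (r : ℕ) (x : F ⊗[R] A r) :
    (T.DF (r + 1)).inv (T.ιF r x) = T.ιF r ((T.DF r).inv x) := by
  induction x using TensorProduct.induction_on with
  | zero => simp
  | add x y hx hy => rw [map_add, map_add, hx, hy, map_add, map_add]
  | tmul f a =>
    change f ⊗ₜ[R] _ = f ⊗ₜ[R] _
    exact congrArg _ (T.ι_inv r a).symm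

/-! ### Seminormal vectors and Gelfand-Zeitlin idempotents -/

theorem f_eq {r : ℕ} {μ : (T.D r).Λ} (t : T.Path r μ) :
    T.f t = (T.DF r).act μ (T.gz t) ((T.D r).mapCell F (T.murphyVec t)) := rfl

/-- The last idempotent acts trivially on the cell module at `μ`, and `δ(μ) d_e` projects to `δ(ν)`
in a filtration quotient. Up to a denominator, the vector of the extended path thus projects to that
of the truncated path, which is nonzero by induction. -/
theorem f_ne_zero {r : ℕ} {μ : (T.D r).Λ} (t : T.Path r μ) : T.f t ≠ 0 := by
  induction t with
  | nil μ =>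
    rw [f_eq, gz, CellDatum.act_one, murphyVec, pathFactor, CellDatum.act_one]
    intro h
    exact T.δ_ne_zero μ ((T.D 0).mapCell_injective F μ (h.trans (CellDatum.mapCell_zero _ F).symm))
  | @cons r ν μ t e ih =>
    obtain ⟨j, rfl⟩ := T.exists_label_eq e
    obtain ⟨hmem, hproj⟩ := T.d_spec μ j e
    -- The filtration lives over `R`, so `F_t` is replaced by a multiple that comes from `A r`.
    obtain ⟨b, hb, a, ha⟩ := exists_smul_eq_one_tmul (T.gz t)
    have h1 : algebraMap R F b • T.f (.cons t e) =
        (T.D (r + 1)).mapCell F ((T.D (r + 1)).act μ (T.ι r (T.pathFactor t * a))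
          ((T.D (r + 1)).act μ (T.d e) (T.δ μ))) := by
      rw [f_eq, gz, CellDatum.act_mul, (T.centralIdem_spec μ).1]
      erw [← CellDatum.act_smul_left]
      rw [← map_smul, ha, ιF_tmul]
      erw [CellDatum.act_baseChange]
      rw [murphyVec, pathFactor, CellDatum.act_mul, map_mul, CellDatum.act_mul]
    have h2 : algebraMap R F b • T.f t = (T.D r).mapCell F ((T.D r).act _
        (T.pathFactor t * a) (T.δ _)) := by
      rw [f_eq]
      erw [← CellDatum.act_smul_left]
      rw [ha]
      erw [CellDatum.act_baseChange]
      rw [murphyVec, CellDatum.act_mul]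
    intro h0
    rw [h0, smul_zero] at h1
    have h3 := (T.D (r + 1)).mapCell_injective F μ
      (h1.symm.trans (CellDatum.mapCell_zero _ F).symm)
    have h4 := (T.filtration μ).proj_act j ⟨_, hmem⟩ (T.pathFactor t * a)
    rw [hproj, ((T.filtration μ).proj_eq_zero j _).2
      (by simp only [h3]; exact Submodule.zero_mem _)] at h4
    rw [← h4, CellDatum.mapCell_zero] at h2
    rcases smul_eq_zero.1 h2 with h | h
    · exact hb (by simpa using h)
    · exact ih h

theorem inv_gz {r : ℕ} {μ : (T.D r).Λ} (t : T.Path r μ) : (T.DF r).inv (T.gz t) = T.gz t := by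
  induction t with
  | nil μ =>
    rw [gz]
    exact (T.DF 0).inv_one
  | @cons r ν μ t e ih =>
    rw [gz, CellDatum.inv_mul, (T.centralIdem_spec μ).2.2.2, inv_ιF, ih,
      (T.centralIdem_spec μ).2.2.1]

theorem gz_mul_self {r : ℕ} {μ : (T.D r).Λ} (t : T.Path r μ) : T.gz t * T.gz t = T.gz t := by
  induction t with
  | nil μ => rw [gz, one_mul]
  | @cons r ν μ t e ih =>
    rw [gz, mul_assoc, (T.centralIdem_spec μ).2.2.1, mul_assoc, centralIdem_mul_self, ← mul_assoc,
      ← map_mul, ih]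

/-- The top idempotents are central and can be collected: distinct final shapes give zero at once,
equal ones leave the product for the truncated paths. At level `0`, where `F_t = 1`, there is only
one path. -/
theorem gz_mul_of_ne {r : ℕ} {μ ν : (T.D r).Λ} (t : T.Path r μ) (u : T.Path r ν)
    (h : (⟨μ, t⟩ : Σ μ, T.Path r μ) ≠ ⟨ν, u⟩) : T.gz t * T.gz u = 0 := by
  induction t with
  | nil μ =>
    cases u with
    | nil ν =>
      have := T.subsingleton_zero
      obtain rfl := Subsingleton.elim μ ν
      exact absurd rfl h
  | @cons r κ μ t e ih =>
    cases u with
    | @cons _ ξ _ u e' =>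
      have hr : T.gz (.cons t e) * T.gz (.cons u e') =
          T.ιF r (T.gz t * T.gz u) * (T.centralIdem μ * T.centralIdem ν) := by
        rw [gz, gz, map_mul, mul_assoc, ← mul_assoc (T.centralIdem μ),
          (T.centralIdem_spec μ).2.2.1, mul_assoc, mul_assoc]
      rw [hr]
      by_cases hμ : μ = ν
      · subst hμ
        rw [ih u, map_zero, zero_mul]
        intro h'
        obtain ⟨rfl, h'⟩ := Sigma.mk.inj_iff.1 h'
        rw [heq_eq_eq] at h'
        subst h'
        exact h rfl
      · rw [T.centralIdem_mul_of_ne hμ, mul_zero]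

theorem act_gz_of_ne {r : ℕ} {μ ν : (T.D r).Λ} (h : μ ≠ ν) (v : T.Path r ν)
    (x : (T.DF r).Cell μ) : (T.DF r).act μ (T.gz v) x = 0 := by
  cases v with
  | nil ν => exact absurd (T.subsingleton_zero.elim μ ν) h
  | cons t e => rw [gz, CellDatum.act_mul, (T.centralIdem_spec _).2.1 μ h]

theorem act_gz_f_self {r : ℕ} {μ : (T.D r).Λ} (t : T.Path r μ) :
    (T.DF r).act μ (T.gz t) (T.f t) = T.f t := by
  rw [f_eq, ← CellDatum.act_mul, gz_mul_self]

theorem act_gz_f_of_ne {r : ℕ} {μ : (T.D r).Λ} {t u : T.Path r μ} (h : t ≠ u) :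
    (T.DF r).act μ (T.gz u) (T.f t) = 0 := by
  rw [f_eq, ← CellDatum.act_mul, T.gz_mul_of_ne t u (fun h' => h (by simpa using h')),
    CellDatum.act_zero_left]

/-- Applying `F_t` to a relation isolates its `t`-term. -/
theorem linearIndependent_f {r : ℕ} (μ : (T.D r).Λ) :
    LinearIndependent F fun t : T.Path r μ => T.f t := by
  rw [Fintype.linearIndependent_iff]
  intro g hg t
  have h := congrArg ((T.DF r).actLin μ (T.gz t)) hg
  rw [map_sum, map_zero, Finset.sum_eq_single t] at h
  · rw [map_smul, CellDatum.actLin_apply, act_gz_f_self] at h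
    exact (smul_eq_zero.1 h).resolve_right (T.f_ne_zero t)
  · intro u _ hu
    rw [map_smul, CellDatum.actLin_apply, act_gz_f_of_ne T hu, smul_zero]
  · simp

theorem card_path {r : ℕ} (μ : (T.D r).Λ) :
    Fintype.card (T.Path r μ) = Fintype.card ((T.D r).Idx μ) := by
  refine le_antisymm ?_ (T.card_idx_le_card_path μ)
  have h := (T.linearIndependent_f μ).fintype_card_le_finrank
  rwa [Module.finrank_fintype_fun_eq_card] at h

theorem span_f {r : ℕ} (μ : (T.D r).Λ) :
    Submodule.span F (Set.range fun t : T.Path r μ => T.f t) = ⊤ :=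
  (T.linearIndependent_f μ).span_eq_top_of_card_eq_finrank' (by
    rw [T.card_path, Module.finrank_fintype_fun_eq_card])

variable {T} in
theorem ext_act_f {r : ℕ} {a b : F ⊗[R] A r}
    (h : ∀ μ (t : T.Path r μ), (T.DF r).act μ a (T.f t) = (T.DF r).act μ b (T.f t)) : a = b :=
  ext_act (T := T) fun μ x => by
    have : (T.DF r).actLin μ a = (T.DF r).actLin μ b :=
      LinearMap.ext_on_range (T.span_f μ) (h μ)
    exact LinearMap.congr_fun this x

/-! ### Rank-one operators and matrix units -/

theorem act_one_tmul_m {r : ℕ} {μ : (T.D r).Λ} (x : (T.DF r).Cell μ) :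
    (T.DF r).act μ (1 ⊗ₜ[R] T.m μ) x =
      T.formF x ((T.D r).mapCell F (T.δ μ)) • (T.D r).mapCell F (T.δ μ) := by
  rw [formF, ← CellDatum.act_tens, CellDatum.tens_baseChange]
  refine CellDatum.act_sub_mem_above _ ?_ x
  rw [← TensorProduct.tmul_sub]
  exact (T.D r).tmul_mem_span F μ (T.m_sub_mem μ)

theorem act_murphy {r : ℕ} {μ : (T.D r).Λ} (u v : T.Path r μ) (x : (T.DF r).Cell μ) :
    (T.DF r).act μ (1 ⊗ₜ[R] T.murphy u v) x =
      T.formF x ((T.D r).mapCell F (T.murphyVec u)) • (T.D r).mapCell F (T.murphyVec v) := by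
  have h : (1 : F) ⊗ₜ[R] T.murphy u v = (T.DF r).inv (1 ⊗ₜ[R] T.pathFactor u) *
      (1 ⊗ₜ[R] T.m μ) * (1 ⊗ₜ[R] T.pathFactor v) := by
    simp [murphy]
  rw [h, CellDatum.act_mul, CellDatum.act_mul, act_one_tmul_m, CellDatum.act_smul, formF,
    CellDatum.form_act, CellDatum.inv_inv, CellDatum.act_baseChange, CellDatum.act_baseChange]
  rfl

/-- The left factor `F_u` is fixed by the involution, so contravariance moves it onto `m_u` inside
the form, while the right factor turns `m_v` into `f_v`. -/
theorem act_Fel {r : ℕ} {μ : (T.D r).Λ} (u v : T.Path r μ) (x : (T.DF r).Cell μ) :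
    (T.DF r).act μ (T.Fel u v) x = T.formF x (T.f u) • T.f v := by
  rw [Fel, CellDatum.act_mul, CellDatum.act_mul, act_murphy, CellDatum.act_smul, formF,
    CellDatum.form_act, inv_gz]
  rfl

theorem act_Fel_of_ne {r : ℕ} {μ ν : (T.D r).Λ} (h : μ ≠ ν) (u v : T.Path r ν)
    (x : (T.DF r).Cell μ) : (T.DF r).act μ (T.Fel u v) x = 0 := by
  rw [Fel, CellDatum.act_mul, act_gz_of_ne T h]

theorem formF_f_of_ne {r : ℕ} {μ : (T.D r).Λ} {t u : T.Path r μ} (h : t ≠ u) :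
    T.formF (T.f t) (T.f u) = 0 := by
  rw [← act_gz_f_self, formF, CellDatum.form_act, inv_gz, act_gz_f_of_ne T h.symm,
    ← zero_smul F (0 : (T.DF r).Cell μ), CellDatum.form_smul_right, zero_mul]

/-- Otherwise `f_t` would be orthogonal to the whole seminormal basis, against nondegeneracy. -/
theorem formF_f_self_ne_zero {r : ℕ} {μ : (T.D r).Λ} (t : T.Path r μ) :
    T.formF (T.f t) (T.f t) ≠ 0 := by
  intro h0
  have := T.isSemisimpleRing r
  refine T.f_ne_zero t ((T.DF r).eq_zero_of_form_eq_zero fun y => ?_)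
  have : (T.DF r).formLin μ (T.f t) = 0 := by
    refine LinearMap.ext_on_range (T.span_f μ) fun u => ?_
    by_cases h : t = u
    · subst h; exact h0
    · exact T.formF_f_of_ne h
  exact LinearMap.congr_fun this y

theorem act_Eel_self {r : ℕ} {μ : (T.D r).Λ} (s t : T.Path r μ) :
    (T.DF r).act μ (T.Eel s t) (T.f s) = T.f t := by
  rw [Eel, CellDatum.act_smul_left, act_Fel, smul_smul, inv_mul_cancel₀ (T.formF_f_self_ne_zero s),
    one_smul]

theorem act_Eel_of_ne {r : ℕ} {μ : (T.D r).Λ} {s u : T.Path r μ} (h : u ≠ s) (t : T.Path r μ) :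
    (T.DF r).act μ (T.Eel s t) (T.f u) = 0 := by
  rw [Eel, CellDatum.act_smul_left, act_Fel, formF_f_of_ne T h, zero_smul, smul_zero]

theorem act_Eel_of_shape_ne {r : ℕ} {μ ν : (T.D r).Λ} (h : μ ≠ ν) (s t : T.Path r ν)
    (x : (T.DF r).Cell μ) : (T.DF r).act μ (T.Eel s t) x = 0 := by
  rw [Eel, CellDatum.act_smul_left, act_Fel_of_ne T h, smul_zero]

theorem Fel_mul_Fel {r : ℕ} {μ : (T.D r).Λ} (s t u v : T.Path r μ) :
    T.Fel s t * T.Fel u v = T.formF (T.f t) (T.f u) • T.Fel s v :=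
  ext_act (T := T) fun κ x => by
    rw [CellDatum.act_mul, CellDatum.act_smul_left]
    by_cases h : κ = μ
    · subst h
      rw [act_Fel, act_Fel, act_Fel, smul_smul, formF, CellDatum.form_smul_left, mul_comm]
      rfl
    · rw [act_Fel_of_ne T h, act_Fel_of_ne T h, smul_zero]

theorem Fel_mul_Fel_of_ne {r : ℕ} {μ ν : (T.D r).Λ} (h : μ ≠ ν) (s t : T.Path r μ)
    (u v : T.Path r ν) : T.Fel s t * T.Fel u v = 0 :=
  ext_act (T := T) fun κ x => by
    rw [CellDatum.act_mul, CellDatum.act_zero_left]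
    by_cases hκ : κ = μ
    · subst hκ; rw [act_Fel_of_ne T h]
    · rw [act_Fel_of_ne T hκ, CellDatum.act_zero]

/-- Both sides fix `f_t` and kill every other seminormal vector, of any shape. -/
theorem Eel_self {r : ℕ} {μ : (T.D r).Λ} (t : T.Path r μ) : T.Eel t t = T.gz t :=
  ext_act_f (T := T) fun κ u => by
    by_cases h : κ = μ
    · subst h
      by_cases hu : u = t
      · subst hu; rw [act_Eel_self, act_gz_f_self]
      · rw [act_Eel_of_ne T hu, act_gz_f_of_ne T hu]
    · rw [act_Eel_of_shape_ne T h, act_gz_of_ne T h]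

theorem Eel_mul_Eel {r : ℕ} {μ : (T.D r).Λ} (s t v : T.Path r μ) :
    T.Eel s t * T.Eel t v = T.Eel s v := by
  rw [Eel, Eel, Eel, smul_mul_smul_comm, Fel_mul_Fel, smul_smul, mul_assoc,
    inv_mul_cancel₀ (T.formF_f_self_ne_zero t), mul_one]

theorem Eel_mul_Eel_of_ne {r : ℕ} {μ : (T.D r).Λ} {t u : T.Path r μ} (h : t ≠ u)
    (s v : T.Path r μ) : T.Eel s t * T.Eel u v = 0 := by
  rw [Eel, Eel, smul_mul_smul_comm, Fel_mul_Fel, formF_f_of_ne T h, zero_smul, smul_zero]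

theorem Eel_mul_Eel_of_shape_ne {r : ℕ} {μ ν : (T.D r).Λ} (h : μ ≠ ν) (s t : T.Path r μ)
    (u v : T.Path r ν) : T.Eel s t * T.Eel u v = 0 := by
  rw [Eel, Eel, smul_mul_smul_comm, Fel_mul_Fel_of_ne T h, smul_zero]

/-- The elements `E_{st}` act on the seminormal bases as matrix units. -/
theorem act_sum_smul_Eel {r : ℕ} (α : ∀ μ : (T.D r).Λ, T.Path r μ → T.Path r μ → F)
    (μ : (T.D r).Λ) (t : T.Path r μ) :
    (T.DF r).act μ (∑ ν, ∑ u : T.Path r ν, ∑ v : T.Path r ν, α ν u v • T.Eel u v) (T.f t) =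
      ∑ v, α μ t v • T.f v := by
  rw [CellDatum.sum_act, Finset.sum_eq_single μ, CellDatum.sum_act, Finset.sum_eq_single t, CellDatum.sum_act]
  · exact Finset.sum_congr rfl fun v _ => by rw [CellDatum.act_smul_left, act_Eel_self]
  · intro u _ hu
    rw [CellDatum.sum_act]
    exact Finset.sum_eq_zero fun v _ => by
      rw [CellDatum.act_smul_left, act_Eel_of_ne T hu.symm, smul_zero]
  · simp
  · intro ν _ hν
    simp only [CellDatum.sum_act]
    exact Finset.sum_eq_zero fun u _ => Finset.sum_eq_zero fun v _ => by
      rw [CellDatum.act_smul_left, act_Eel_of_shape_ne T hν.symm, smul_zero]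
  · simp

theorem sum_Eel_self (r : ℕ) : ∑ μ : (T.D r).Λ, ∑ s : T.Path r μ, T.Eel s s = 1 :=
  ext_act_f (T := T) fun μ t => by
    classical
    have h := T.act_sum_smul_Eel (fun _ u v => if u = v then 1 else 0) μ t
    simp only [ite_smul, one_smul, zero_smul, Finset.sum_ite_eq, Finset.mem_univ, if_true] at h
    rw [h, CellDatum.act_one]

theorem span_Eel (r : ℕ) : Submodule.span F (Set.range
    (fun i : Σ μ : (T.D r).Λ, T.Path r μ × T.Path r μ => T.Eel i.2.1 i.2.2)) = ⊤ := by
  refine eq_top_iff.2 fun a _ => ?_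
  have h : ∀ (μ : (T.D r).Λ) (t : T.Path r μ), ∃ g : T.Path r μ → F,
      ∑ v, g v • T.f v = (T.DF r).act μ a (T.f t) := fun μ t =>
    (Submodule.mem_span_range_iff_exists_fun F).1 (by rw [T.span_f]; trivial)
  -- The coefficients of `a` are the entries of its matrices in the seminormal bases.
  choose α hα using h
  have ha : a = ∑ ν, ∑ u : T.Path r ν, ∑ v : T.Path r ν, α ν u v • T.Eel u v :=
    ext_act_f (T := T) fun μ t => by rw [act_sum_smul_Eel, hα]
  rw [ha]
  exact Submodule.sum_mem _ fun ν _ => Submodule.sum_mem _ fun u _ => Submodule.sum_mem _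
    fun v _ => Submodule.smul_mem _ _ (Submodule.subset_span ⟨⟨ν, u, v⟩, rfl⟩)

theorem linearIndependent_Eel (r : ℕ) : LinearIndependent F
    (fun i : Σ μ : (T.D r).Λ, T.Path r μ × T.Path r μ => T.Eel i.2.1 i.2.2) :=
  linearIndependent_of_top_le_span_of_card_eq_finrank (T.span_Eel r).ge (by
    rw [(T.DF r).finrank_eq, Fintype.card_sigma]
    exact Finset.sum_congr rfl fun μ _ => by rw [Fintype.card_prod, T.card_path])

end

end DiagramTower

end

theorem mainTheorem11 {R F : Type*} {A : ℕ → Type*} [CommRing R] [IsDomain R] [Field F]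
    [Algebra R F] [IsFractionRing R F] [∀ r, Ring (A r)] [∀ r, Algebra R (A r)]
    (T : DiagramTower R F A) (r : ℕ) :
    -- (1)
    (∀ (μ : (T.D r).Λ) (t u v : T.Path r μ),
      (T.DF r).act μ (T.Fel u v) (T.f t) = T.formF (T.f t) (T.f u) • T.f v) ∧
    (∀ (μ ν : (T.D r).Λ) (t : T.Path r μ) (u v : T.Path r ν), μ ≠ ν →
      (T.DF r).act μ (T.Fel u v) (T.f t) = 0) ∧
    -- (2)
    (∀ (μ : (T.D r).Λ) (s t u v : T.Path r μ),
      T.Fel s t * T.Fel u v = T.formF (T.f t) (T.f u) • T.Fel s v) ∧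
    (∀ (μ ν : (T.D r).Λ) (s t : T.Path r μ) (u v : T.Path r ν), μ ≠ ν →
      T.Fel s t * T.Fel u v = 0) ∧
    -- (3)
    (∀ (μ : (T.D r).Λ) (t u : T.Path r μ), T.formF (T.f t) (T.f u) ≠ 0 ↔ t = u) ∧
    -- (4)
    (∀ (μ : (T.D r).Λ) (t : T.Path r μ),
      (T.formF (T.f t) (T.f t))⁻¹ • T.Fel t t = T.gz t) ∧
    -- (5): multiplication rules
    (∀ (μ : (T.D r).Λ) (s t v : T.Path r μ), T.Eel s t * T.Eel t v = T.Eel s v) ∧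
    (∀ (μ : (T.D r).Λ) (s t u v : T.Path r μ), t ≠ u → T.Eel s t * T.Eel u v = 0) ∧
    (∀ (μ ν : (T.D r).Λ) (s t : T.Path r μ) (u v : T.Path r ν), μ ≠ ν →
      T.Eel s t * T.Eel u v = 0) ∧
    (∀ (μ : (T.D r).Λ) (s t : T.Path r μ),
      T.Eel s t * T.Eel t s = T.Eel s s ∧ T.Eel s s = T.gz s) ∧
    -- (5): completeness
    (∑ μ : (T.D r).Λ, ∑ s : T.Path r μ, T.Eel s s = 1) ∧
    LinearIndependent F
      (fun i : Σ μ : (T.D r).Λ, T.Path r μ × T.Path r μ => T.Eel i.2.1 i.2.2) ∧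
    Submodule.span F (Set.range
      (fun i : Σ μ : (T.D r).Λ, T.Path r μ × T.Path r μ => T.Eel i.2.1 i.2.2)) = ⊤ := by
  refine ⟨fun μ t u v => T.act_Fel u v _, fun μ ν t u v h => T.act_Fel_of_ne h u v _,
    fun μ => T.Fel_mul_Fel, fun μ ν s t u v h => T.Fel_mul_Fel_of_ne h s t u v,
    fun μ t u => ⟨fun h => not_imp_comm.1 T.formF_f_of_ne h, ?_⟩, fun μ => T.Eel_self,
    fun μ => T.Eel_mul_Eel, fun μ s t u v h => T.Eel_mul_Eel_of_ne h s v,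
    fun μ ν s t u v h => T.Eel_mul_Eel_of_shape_ne h s t u v,
    fun μ s t => ⟨T.Eel_mul_Eel s t s, T.Eel_self s⟩, T.sum_Eel_self r,
    T.linearIndependent_Eel r, T.span_Eel r⟩
  rintro rfl
  exact T.formF_f_self_ne_zero t
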